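/- **Setting.** An instance of the constrained bandit recommendation problem consists of $U \ge 1$ users, $K \ge 1$ arms, a horizon $T \ge \max\{U, K\}$, a budget $B \in \mathbb{N}$, arm costs $0 < c_k \le B$, and, for every user $u$ and arm $k$, a probability distribution $D_{u,k}$ supported on $[0,1]$ with mean $\theta_{u,k}$. No structure is assumed on the matrix $\Theta = (\theta_{u,k})$. A matching is a map $\pi : [U] \to [K]$. It is feasible if $\sum_{k \in \mathrm{Im}(\pi)} c_k \le B$, and its value is $V(\pi;\Theta) = \sum_{u} \theta_{u,\pi(u)}$; $\Pi$ denotes the set of feasible matchings. In each round $t = 1, \dots, T$ the learner, who knows $T, U, K, B, (c_k)_k$ but not the distributions, plays a feasible matching $\pi_t$ that depends on past observations, and then observes the rewards $r^t_{u,\pi_t(u)}$, $u \in [U]$, where the $r^t_{u,k} \sim D_{u,k}$ are independent over all $t, u, k$. For $\alpha \in (0,1]$ its expected cumulative $\alpha$-regret is $$R_\alpha(T) = \alpha \, T \max_{\pi \in \Pi} V(\pi;\Theta) - \mathbb{E}\Big[\sum_{t=1}^T \sum_{u \in [U]} r^t_{u,\pi_t(u)}\Big].$$ Running time is measured by the number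 of steps of a program for a real random access machine: unit-cost memory access, comparison, addition and truncated subtraction of natural numbers, field operations on real numbers, and conversion of a natural number to a real number; there is no rounding of real numbers. The program is run once in each round, its memory persists between rounds, it finds $T, U, K, B, (c_k)_k$ in memory before the first round, and the new observations are written to its memory after each round. **Proposition.** There are a single program and universal constants $C_1, C_2$ such that for every instance as above the program plays a feasible matching in every round, uses at most $C_1 K^3 U$ steps in every round (whatever it observes), and satisfies $$R_{1/2}(T) \le C_2\, U\, (K + \beta)^{4/3}\, T^{2/3} (\log T)^{1/3}, \qquad \beta = \frac{B}{\min_k c_k}.$$ In particular $R_{1/2}(T) = \tilde O\big(U (K+\beta)^{4/3} T^{2/3}\big)$, with per-round time $O(K^3 U)$. -/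

import Mathlib

open MeasureTheory

/-! ### The constrained bandit recommendation problem -/

namespace CBR

/-- The part of an instance that is known to the learner: horizon `T`, number of users `U`, number of
arms `K`, budget `B` and arm costs. Users, arms and rounds are numbered from `0`. -/
structure Params where
  T : ℕ
  U : ℕ
  K : ℕ
  B : ℕ
  cost : Fin K → ℝ
  U_pos : 0 < U
  K_pos : 0 < K
  U_le_T : U ≤ T
  K_le_T : K ≤ T
  cost_pos : ∀ k, 0 < cost k
  cost_le : ∀ k, cost k ≤ B

/-- A matching assigns one arm to each user. -/
abbrev Matching (P : Params) : Type := Fin P.U → Fin P.K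

/-- A matching is feasible if the total cost of the arms in its image is within the budget. -/
def Feasible (P : Params) (π : Matching P) : Prop :=
  ∑ k ∈ Finset.univ.image π, P.cost k ≤ P.B

/-- The ratio of the budget to the minimal cost (the infimum is over a finite nonempty set). -/
noncomputable def beta (P : Params) : ℝ := P.B / ⨅ k, P.cost k

/-- The part of an instance that is unknown to the learner: a reward distribution, supported on
`[0, 1]`, for each user and arm. -/
structure Env (P : Params) where
  D : Fin P.U → Fin P.K → Measure ℝ
  prob : ∀ u k, IsProbabilityMeasure (D u k)
  supp : ∀ u k, ∀ᵐ x ∂(D u k), x ∈ Set.Icc (0 : ℝ) 1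

/-- The expected reward matrix. -/
noncomputable def Env.theta {P : Params} (E : Env P) (u : Fin P.U) (k : Fin P.K) : ℝ :=
  ∫ x, x ∂(E.D u k)

/-- The expected value of a matching. -/
noncomputable def Env.value {P : Params} (E : Env P) (π : Matching P) : ℝ :=
  ∑ u, E.theta u (π u)

/-- The largest value of a feasible matching. -/
noncomputable def Env.opt {P : Params} (E : Env P) : ℝ :=
  sSup (E.value '' {π | Feasible P π})

/-- The supremum in `Env.opt` is a maximum. -/
theorem Env.isGreatest_opt {P : Params} (E : Env P) :
    IsGreatest (E.value '' {π | Feasible P π}) E.opt := by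
  have hfin : (E.value '' {π | Feasible P π}).Finite := (Set.toFinite _).image _
  suffices hne : (E.value '' {π | Feasible P π}).Nonempty from
    ⟨hne.csSup_mem hfin, fun _ hv => le_csSup hfin.bddAbove hv⟩
  refine ⟨_, fun _ => ⟨0, P.K_pos⟩, ?_, rfl⟩
  have : Nonempty (Fin P.U) := ⟨⟨0, P.U_pos⟩⟩
  simp only [Set.mem_ofPred_eq, Feasible]
  rw [Finset.image_const Finset.univ_nonempty, Finset.sum_singleton]
  exact P.cost_le _

/-- A table of potential rewards: the entry `(t, u, k)` is the reward that is generated in round `t`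
if user `u` is matched to arm `k` in that round. -/
abbrev Table (P : Params) : Type := ℕ × Fin P.U × Fin P.K → ℝ

/-- The law of the table: independent entries, the entry `(t, u, k)` having law `D u k`. -/
noncomputable def Env.law {P : Params} (E : Env P) : Measure (Table P) :=
  haveI : ∀ i : ℕ × Fin P.U × Fin P.K, IsProbabilityMeasure (E.D i.2.1 i.2.2) :=
    fun i => E.prob i.2.1 i.2.2
  Measure.infinitePi fun i : ℕ × Fin P.U × Fin P.K => E.D i.2.1 i.2.2

/-- What is observed in a round (semi-bandit feedback): the reward of each user from its own arm. -/
abbrev Obs (P : Params) : Type := Fin P.U → ℝ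

/-- A deterministic learner: the matching of the next round as a function of the observations of the
past rounds, latest first. (The past matchings are determined by the past observations.) -/
abbrev Learner (P : Params) : Type := List (Obs P) → Matching P

/-- The observations of the rounds before round `t`, latest first, when learner `A` plays against
the table `r`. -/
def Learner.history {P : Params} (A : Learner P) (r : Table P) : ℕ → List (Obs P)
  | 0 => []
  | t + 1 => (fun u => r (t, u, A (Learner.history A r t) u)) :: Learner.history A r t

/-- The matching that is played in round `t`. -/
def Learner.play {P : Params} (A : Learner P) (r : Table P) (t : ℕ) : Matching P :=
  A (Learner.history A r t)

/-- The total realized reward of rounds `0, …, T - 1`. -/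
noncomputable def Learner.reward {P : Params} (A : Learner P) (r : Table P) : ℝ :=
  ∑ t ∈ Finset.range P.T, ∑ u, r (t, u, Learner.play A r t u)

/-- The expected cumulative `α`-regret over `T` rounds. -/
noncomputable def alphaRegret {P : Params} (α : ℝ) (E : Env P) (A : Learner P) : ℝ :=
  α * P.T * E.opt - ∫ r, Learner.reward A r ∂E.law

end CBR

/-! ### The real random access machine

The memory consists of arrays of natural numbers and arrays of real numbers. An elementary step is a
memory access, an addition or (truncated) subtraction of naturals, a field operation on reals, the
conversion of a natural number to a real number, a comparison, a Boolean connective, or the transfer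
of control. There is no rounding, and no unit-cost multiplication of naturals. -/

namespace RealRAM

/-- The memory: cell `i` of the array `a` of naturals, and of the array `a` of reals. -/
structure Mem where
  nat : ℕ → ℕ → ℕ
  real : ℕ → ℕ → ℝ

/-- Overwrite cell `i` of the array `a` of naturals. -/
def Mem.setNat (m : Mem) (a i v : ℕ) : Mem :=
  { m with nat := Function.update m.nat a (Function.update (m.nat a) i v) }

/-- Overwrite cell `i` of the array `a` of reals. -/
noncomputable def Mem.setReal (m : Mem) (a i : ℕ) (v : ℝ) : Mem :=
  { m with real := Function.update m.real a (Function.update (m.real a) i v) }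

/-- Natural number expressions. `get a e` is the cell of the array `a` whose index is the value
of `e`. -/
inductive NExp where
  | lit (n : ℕ)
  | get (a : ℕ) (e : NExp)
  | add (e₁ e₂ : NExp)
  | sub (e₁ e₂ : NExp)

/-- Real expressions. -/
inductive RExp where
  | ofNat (e : NExp)
  | get (a : ℕ) (e : NExp)
  | add (e₁ e₂ : RExp)
  | sub (e₁ e₂ : RExp)
  | mul (e₁ e₂ : RExp)
  | div (e₁ e₂ : RExp)

/-- Tests. -/
inductive Test where
  | natLe (e₁ e₂ : NExp)
  | realLe (e₁ e₂ : RExp)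
  | neg (b : Test)
  | conj (b₁ b₂ : Test)

def NExp.eval (m : Mem) : NExp → ℕ
  | lit n => n
  | get a e => m.nat a (e.eval m)
  | add e₁ e₂ => e₁.eval m + e₂.eval m
  | sub e₁ e₂ => e₁.eval m - e₂.eval m

noncomputable def RExp.eval (m : Mem) : RExp → ℝ
  | ofNat e => (e.eval m : ℝ)
  | get a e => m.real a (e.eval m)
  | add e₁ e₂ => e₁.eval m + e₂.eval m
  | sub e₁ e₂ => e₁.eval m - e₂.eval m
  | mul e₁ e₂ => e₁.eval m * e₂.eval m
  | div e₁ e₂ => e₁.eval m / e₂.eval m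

def Test.holds (m : Mem) : Test → Prop
  | natLe e₁ e₂ => e₁.eval m ≤ e₂.eval m
  | realLe e₁ e₂ => e₁.eval m ≤ e₂.eval m
  | neg b => ¬ b.holds m
  | conj b₁ b₂ => b₁.holds m ∧ b₂.holds m

/-- The number of steps of an evaluation: one for each node of the expression. -/
def NExp.steps : NExp → ℕ
  | lit _ => 1
  | get _ e => e.steps + 1
  | add e₁ e₂ => e₁.steps + e₂.steps + 1
  | sub e₁ e₂ => e₁.steps + e₂.steps + 1

def RExp.steps : RExp → ℕ
  | ofNat e => e.steps + 1
  | get _ e => e.steps + 1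
  | add e₁ e₂ => e₁.steps + e₂.steps + 1
  | sub e₁ e₂ => e₁.steps + e₂.steps + 1
  | mul e₁ e₂ => e₁.steps + e₂.steps + 1
  | div e₁ e₂ => e₁.steps + e₂.steps + 1

def Test.steps : Test → ℕ
  | natLe e₁ e₂ => e₁.steps + e₂.steps + 1
  | realLe e₁ e₂ => e₁.steps + e₂.steps + 1
  | neg b => b.steps + 1
  | conj b₁ b₂ => b₁.steps + b₂.steps + 1

/-- Programs. `setNat a i e` and `setReal a i e` store the value of `e` in cell `i` of the array
`a`; `loop b c` repeats `c` as long as `b` holds. -/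
inductive Prog where
  | skip
  | setNat (a : ℕ) (i e : NExp)
  | setReal (a : ℕ) (i : NExp) (e : RExp)
  | seq (c₁ c₂ : Prog)
  | cond (b : Test) (c₁ c₂ : Prog)
  | loop (b : Test) (c : Prog)

/-- `Exec c m n m'`: started in memory `m`, the program `c` halts after `n` steps in memory `m'`. -/
inductive Exec : Prog → Mem → ℕ → Mem → Prop where
  | skip (m : Mem) : Exec .skip m 1 m
  | setNat (a : ℕ) (i e : NExp) (m : Mem) :
      Exec (.setNat a i e) m (i.steps + e.steps + 1) (m.setNat a (i.eval m) (e.eval m))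
  | setReal (a : ℕ) (i : NExp) (e : RExp) (m : Mem) :
      Exec (.setReal a i e) m (i.steps + e.steps + 1) (m.setReal a (i.eval m) (e.eval m))
  | seq {c₁ c₂ : Prog} {m m' m'' : Mem} {n₁ n₂ : ℕ} :
      Exec c₁ m n₁ m' → Exec c₂ m' n₂ m'' → Exec (.seq c₁ c₂) m (n₁ + n₂ + 1) m''
  | condTrue {b : Test} {c₁ c₂ : Prog} {m m' : Mem} {n : ℕ} :
      b.holds m → Exec c₁ m n m' → Exec (.cond b c₁ c₂) m (b.steps + n + 1) m'
  | condFalse {b : Test} {c₁ c₂ : Prog} {m m' : Mem} {n : ℕ} :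
      ¬ b.holds m → Exec c₂ m n m' → Exec (.cond b c₁ c₂) m (b.steps + n + 1) m'
  | loopStop {b : Test} {c : Prog} {m : Mem} :
      ¬ b.holds m → Exec (.loop b c) m (b.steps + 1) m
  | loopStep {b : Test} {c : Prog} {m m' m'' : Mem} {n₁ n₂ : ℕ} :
      b.holds m → Exec c m n₁ m' → Exec (.loop b c) m' n₂ m'' →
        Exec (.loop b c) m (b.steps + n₁ + n₂ + 1) m''

/-- Programs are deterministic. -/
theorem Exec.unique {c : Prog} {m m₁ m₂ : Mem} {n₁ n₂ : ℕ}
    (h₁ : Exec c m n₁ m₁) (h₂ : Exec c m n₂ m₂) : n₁ = n₂ ∧ m₁ = m₂ := by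
  induction h₁ generalizing n₂ m₂ with
  | skip m => cases h₂; exact ⟨rfl, rfl⟩
  | setNat a i e m => cases h₂; exact ⟨rfl, rfl⟩
  | setReal a i e m => cases h₂; exact ⟨rfl, rfl⟩
  | seq _ _ ih₁ ih₂ =>
    cases h₂ with
    | seq g₁ g₂ =>
      obtain ⟨rfl, rfl⟩ := ih₁ g₁
      obtain ⟨rfl, rfl⟩ := ih₂ g₂
      exact ⟨rfl, rfl⟩
  | condTrue hb _ ih =>
    cases h₂ with
    | condTrue _ g => obtain ⟨rfl, rfl⟩ := ih g; exact ⟨rfl, rfl⟩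
    | condFalse hb' _ => exact absurd hb hb'
  | condFalse hb _ ih =>
    cases h₂ with
    | condTrue hb' _ => exact absurd hb' hb
    | condFalse _ g => obtain ⟨rfl, rfl⟩ := ih g; exact ⟨rfl, rfl⟩
  | loopStop hb =>
    cases h₂ with
    | loopStop _ => exact ⟨rfl, rfl⟩
    | loopStep hb' _ _ => exact absurd hb' hb
  | loopStep hb _ _ ih₁ ih₂ =>
    cases h₂ with
    | loopStop hb' => exact absurd hb hb'
    | loopStep _ g₁ g₂ =>
      obtain ⟨rfl, rfl⟩ := ih₁ g₁
      obtain ⟨rfl, rfl⟩ := ih₂ g₂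
      exact ⟨rfl, rfl⟩

open CBR

/-- The memory before the first round: the array `0` of naturals holds `T, U, K, B`, the array `0`
of reals holds the costs, and all other cells are `0`. -/
noncomputable def initMem (P : Params) : Mem where
  nat a i :=
    if a = 0 then
      (if i = 0 then P.T else if i = 1 then P.U else if i = 2 then P.K else if i = 3 then P.B else 0)
    else 0
  real a i := if a = 0 then (if h : i < P.K then P.cost ⟨i, h⟩ else 0) else 0

/-- At the end of a round the observed rewards are written to the cells `0, …, U - 1` of the array
`1` of reals. -/
noncomputable def observe {P : Params} (m : Mem) (x : Obs P) : Mem :=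
  { m with
    real := Function.update m.real 1 fun i => if h : i < P.U then x ⟨i, h⟩ else m.real 1 i }

/-- `AtRound c P h m`: if the program `c` is executed once in each round, then `m` is the memory at
the beginning of the round that follows the observations `h` (latest first). The memory persists
from round to round. -/
inductive AtRound (c : Prog) (P : Params) : List (Obs P) → Mem → Prop where
  | start : AtRound c P [] (initMem P)
  | next {h : List (Obs P)} {m m' : Mem} {n : ℕ} (x : Obs P) :
      AtRound c P h m → Exec c m n m' → AtRound c P (x :: h) (observe m' x)

/-- The program `c`, executed once in each of the `T` rounds, implements the learner `A` with at most
`τ` steps in every round, whatever is observed: it halts within `τ` steps, and it leaves the matching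
of the round in the cells `0, …, U - 1` of the array `1` of naturals. -/
def Implements (c : Prog) {P : Params} (A : Learner P) (τ : ℕ) : Prop :=
  ∀ (h : List (Obs P)) (m : Mem), h.length < P.T → AtRound c P h m →
    ∃ (n : ℕ) (m' : Mem), Exec c m n m' ∧ n ≤ τ ∧ ∀ u : Fin P.U, m'.nat 1 u = (A h u : ℕ)

end RealRAM

/-! The learner explores, then commits. For `N = exploreLen T`, about `T^(2/3)`, sweeps over the
arms, all users are matched to one arm, which is feasible because each cost is at most `B`.
Afterwards it plays the output of a greedy algorithm run on the observed reward sums.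

Greedy (namespace `GreedyMax`): `G` grows by the fitting arm of largest gain per cost, and every
extension of `G` by one fitting arm competes for the best matching. Let `π` be feasible and `o` its
most expensive arm. As long as `cG ≤ B - c o`, every arm of `π` fits. If in addition `2 * best < val
π`, then bounding `val π` by `fG` plus the gains of its arms, and charging `o` to the candidate `G ∪
{o}`, shows that the density of the greedy choice exceeds `val π / (2 * (B - c o))`
(`Scan.lt_dens`). Hence `val π * cG ≤ 2 * fG * (B - c o)` persists (`Inv.step`), and once `cG`
passes `B - c o` it gives `val π ≤ 2 * fG`. Otherwise each step adds a new arm, and after `K` steps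
`G` contains all arms. So the output has at least half of the value of every feasible matching
(`Inv.half_le`).

Regret: a sum of `N` independent rewards in `[0, 1]` deviates from its mean by at most `√N` in
expectation, by its variance. Summing over all pairs of a user and an arm gives an error `U * K *
√N` that is valid for all matchings at once, so a commitment round loses at most `3/2 * U * K / √N`
against half of the optimum. An exploration round loses at most `U / 2`. The total is at most `5/2 *
U * K * T^(2/3)`. No concentration inequality is needed; `beta` and the logarithm only enlarge the
bound, except that for `T = 1` the logarithm vanishes.

The learner is defined by an interpreter with bounded fuel, a total function of the memory. This
makes the matchings measurable functions of the reward table. The steps and outputs of the program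
are established by weakest preconditions. -/

namespace RealRAM

open CBR

/-! ### A fuelled interpreter -/

/-- Run a program with a bounded amount of fuel. -/
noncomputable def evalFuel : ℕ → Prog → Mem → Mem
  | 0, _, m => m
  | _ + 1, .skip, m => m
  | _ + 1, .setNat a i e, m => m.setNat a (i.eval m) (e.eval m)
  | _ + 1, .setReal a i e, m => m.setReal a (i.eval m) (e.eval m)
  | f + 1, .seq c₁ c₂, m => evalFuel f c₂ (evalFuel f c₁ m)
  | f + 1, .cond b c₁ c₂, m =>
    open Classical in if b.holds m then evalFuel f c₁ m else evalFuel f c₂ m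
  | f + 1, .loop b c, m =>
    open Classical in if b.holds m then evalFuel f (.loop b c) (evalFuel f c m) else m

/-- Each recursive call lowers the fuel by one, and the step count of a compound program exceeds
that of each of its parts by at least one. Hence fuel equal to the number of steps never runs out
early. -/
theorem Exec.evalFuel_eq {c : Prog} {m m' : Mem} {n : ℕ} (h : Exec c m n m') {f : ℕ}
    (hf : n ≤ f) : evalFuel f c m = m' := by
  induction h generalizing f with
  | skip m => cases f <;> simp [evalFuel]
  | setNat a i e m =>
    obtain _ | f := f
    · omega
    · simp [evalFuel]
  | setReal a i e m =>
    obtain _ | f := f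
    · omega
    · simp [evalFuel]
  | seq _ _ ih₁ ih₂ =>
    obtain _ | f := f
    · omega
    · rw [evalFuel, ih₁ (by omega), ih₂ (by omega)]
  | condTrue hb _ ih =>
    obtain _ | f := f
    · omega
    · rw [evalFuel, if_pos hb, ih (by omega)]
  | condFalse hb _ ih =>
    obtain _ | f := f
    · omega
    · rw [evalFuel, if_neg hb, ih (by omega)]
  | loopStop hb =>
    obtain _ | f := f
    · omega
    · rw [evalFuel, if_neg hb]
  | loopStep hb _ _ ih₁ ih₂ =>
    obtain _ | f := f
    · omega
    · rw [evalFuel, if_pos hb, ih₁ (by omega), ih₂ (by omega)]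

/-! ### Measurability -/

/-- A random memory all of whose cells are measurable. -/
def MeasurableMem {Ω : Type*} [MeasurableSpace Ω] (φ : Ω → Mem) : Prop :=
  ∀ a i, Measurable (fun ω => (φ ω).nat a i) ∧ Measurable (fun ω => (φ ω).real a i)

section Measurability

variable {Ω : Type*} [MeasurableSpace Ω]

/-- Used for a memory access at a random address and for the reward of a randomly chosen arm: the
preimage splits into countably many pieces according to the index. -/
theorem measurable_apply_countable {ι β : Type*} [Countable ι] [MeasurableSpace ι]
    [MeasurableSingletonClass ι] [MeasurableSpace β] {g : Ω → ι} {f : ι → Ω → β}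
    (hf : ∀ i, Measurable (f i)) (hg : Measurable g) : Measurable fun ω => f (g ω) ω := by
  intro s hs
  have : (fun ω => f (g ω) ω) ⁻¹' s = ⋃ i, g ⁻¹' {i} ∩ f i ⁻¹' s := by
    ext ω; simp
  rw [this]
  exact .iUnion fun i => (hg (measurableSet_singleton i)).inter (hf i hs)

theorem MeasurableMem.nexp {φ : Ω → Mem} (hφ : MeasurableMem φ) (e : NExp) :
    Measurable fun ω => e.eval (φ ω) := by
  induction e with
  | lit n => exact measurable_const
  | get a e ih => exact measurable_apply_countable (fun i => (hφ a i).1) ih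
  | add e₁ e₂ ih₁ ih₂ => exact ih₁.add ih₂
  | sub e₁ e₂ ih₁ ih₂ => exact ih₁.sub ih₂

theorem MeasurableMem.rexp {φ : Ω → Mem} (hφ : MeasurableMem φ) (e : RExp) :
    Measurable fun ω => e.eval (φ ω) := by
  induction e with
  | ofNat e => exact measurable_from_top.comp (hφ.nexp e)
  | get a e => exact measurable_apply_countable (fun i => (hφ a i).2) (hφ.nexp e)
  | add e₁ e₂ ih₁ ih₂ => exact ih₁.add ih₂
  | sub e₁ e₂ ih₁ ih₂ => exact ih₁.sub ih₂
  | mul e₁ e₂ ih₁ ih₂ => exact ih₁.mul ih₂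
  | div e₁ e₂ ih₁ ih₂ => exact ih₁.div ih₂

theorem MeasurableMem.test {φ : Ω → Mem} (hφ : MeasurableMem φ) (b : Test) :
    MeasurableSet {ω | b.holds (φ ω)} := by
  induction b with
  | natLe e₁ e₂ => exact measurableSet_le (hφ.nexp e₁) (hφ.nexp e₂)
  | realLe e₁ e₂ => exact measurableSet_le (hφ.rexp e₁) (hφ.rexp e₂)
  | neg b ih => exact ih.compl
  | conj b₁ b₂ ih₁ ih₂ => exact ih₁.inter ih₂

theorem MeasurableMem.ite {φ ψ : Ω → Mem} (hφ : MeasurableMem φ) (hψ : MeasurableMem ψ)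
    {p : Ω → Prop} [DecidablePred p] (hp : MeasurableSet {ω | p ω}) :
    MeasurableMem fun ω => if p ω then φ ω else ψ ω := by
  intro a i
  constructor
  · simp only [apply_ite (fun m : Mem => m.nat a i)]
    exact Measurable.ite hp (hφ a i).1 (hψ a i).1
  · simp only [apply_ite (fun m : Mem => m.real a i)]
    exact Measurable.ite hp (hφ a i).2 (hψ a i).2

theorem MeasurableMem.setNat {φ : Ω → Mem} (hφ : MeasurableMem φ) (a : ℕ) {i v : Ω → ℕ}
    (hi : Measurable i) (hv : Measurable v) :
    MeasurableMem fun ω => (φ ω).setNat a (i ω) (v ω) := by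
  intro b j
  refine ⟨?_, (hφ b j).2⟩
  by_cases hb : b = a
  · subst hb
    simp only [Mem.setNat, Function.update_self, Function.update_apply]
    exact Measurable.ite (measurableSet_eq_fun measurable_const hi) hv (hφ b j).1
  · simpa [Mem.setNat, Function.update_of_ne hb] using (hφ b j).1

theorem MeasurableMem.setReal {φ : Ω → Mem} (hφ : MeasurableMem φ) (a : ℕ) {i : Ω → ℕ}
    {v : Ω → ℝ} (hi : Measurable i) (hv : Measurable v) :
    MeasurableMem fun ω => (φ ω).setReal a (i ω) (v ω) := by
  intro b j
  refine ⟨(hφ b j).1, ?_⟩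
  by_cases hb : b = a
  · subst hb
    simp only [Mem.setReal, Function.update_self, Function.update_apply]
    exact Measurable.ite (measurableSet_eq_fun measurable_const hi) hv (hφ b j).2
  · simpa [Mem.setReal, Function.update_of_ne hb] using (hφ b j).2

/-- Induction on the fuel rather than on the program: it also covers loops, whose number of
iterations is random. -/
theorem MeasurableMem.evalFuel {φ : Ω → Mem} (hφ : MeasurableMem φ) (f : ℕ) (c : Prog) :
    MeasurableMem fun ω => evalFuel f c (φ ω) := by
  induction f generalizing c φ with
  | zero => exact hφ
  | succ f ih =>
    cases c with
    | skip => exact hφ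
    | setNat a i e => exact hφ.setNat a (hφ.nexp i) (hφ.nexp e)
    | setReal a i e => exact hφ.setReal a (hφ.nexp i) (hφ.rexp e)
    | seq c₁ c₂ => exact ih (ih hφ c₁) c₂
    | cond b c₁ c₂ =>
      classical exact (ih hφ c₁).ite (ih hφ c₂) (hφ.test b)
    | loop b c =>
      classical exact (ih (ih hφ c) (.loop b c)).ite hφ (hφ.test b)

theorem MeasurableMem.observe {P : Params} {φ : Ω → Mem} (hφ : MeasurableMem φ)
    {x : Ω → Obs P} (hx : ∀ u, Measurable fun ω => x ω u) :
    MeasurableMem fun ω => observe (φ ω) (x ω) := by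
  intro b j
  refine ⟨(hφ b j).1, ?_⟩
  by_cases hb : b = 1
  · subst hb
    simp only [RealRAM.observe, Function.update_self]
    split_ifs with h
    · exact hx _
    · exact (hφ 1 j).2
  · simpa [RealRAM.observe, Function.update_of_ne hb] using (hφ b j).2

end Measurability

/-! ### The learner of a program -/

/-- The memory at the beginning of the round that follows the observations, if every round is run
with fuel `f`. -/
noncomputable def memAfter (f : ℕ) (c : Prog) (P : Params) : List (Obs P) → Mem
  | [] => initMem P
  | x :: h => observe (evalFuel f c (memAfter f c P h)) x

/-- The learner defined by running a program with fuel `f` in every round. -/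
noncomputable def progLearner (f : ℕ) (c : Prog) (P : Params) : Learner P := fun h u =>
  ⟨(evalFuel f c (memAfter f c P h)).nat 1 u % P.K, Nat.mod_lt _ P.K_pos⟩

theorem measurable_progLearner (f : ℕ) (c : Prog) (P : Params) (t : ℕ) (u : Fin P.U) :
    Measurable fun r => (progLearner f c P).play r t u := by
  have key : ∀ φ : Table P → Mem, MeasurableMem φ → ∀ u : Fin P.U,
      Measurable fun r => (⟨(evalFuel f c (φ r)).nat 1 u % P.K, Nat.mod_lt _ P.K_pos⟩ : Fin P.K) :=
    fun φ hφ u => (measurable_from_top (f := fun n : ℕ =>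
      (⟨n % P.K, Nat.mod_lt _ P.K_pos⟩ : Fin P.K))).comp ((hφ.evalFuel f c) 1 u).1
  have hmem : MeasurableMem fun r => memAfter f c P ((progLearner f c P).history r t) := by
    induction t with
    | zero => exact fun a i => ⟨measurable_const, measurable_const⟩
    | succ t ih =>
      refine (ih.evalFuel f c).observe fun v => ?_
      exact measurable_apply_countable (f := fun k (r : Table P) => r (t, v, k))
        (fun k => measurable_pi_apply _) (key _ ih v)
  exact key _ hmem u

/-- A program which in every reachable round halts in time and leaves arms in the output cells
implements its learner. -/
theorem implements_progLearner {f : ℕ} {c : Prog} {P : Params}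
    (hc : ∀ h m, AtRound c P h m →
      ∃ n m', Exec c m n m' ∧ n ≤ f ∧ ∀ u < P.U, m'.nat 1 u < P.K) :
    Implements c (progLearner f c P) f ∧
      ∀ h m n m', AtRound c P h m → Exec c m n m' →
        ∀ u : Fin P.U, (progLearner f c P h u : ℕ) = m'.nat 1 u := by
  have hmem : ∀ h m, AtRound c P h m → memAfter f c P h = m := by
    intro h m hm
    induction hm with
    | start => rfl
    | next x hm he ih =>
      obtain ⟨n₁, m₁, he₁, hn₁, -⟩ := hc _ _ hm
      obtain ⟨rfl, rfl⟩ := he.unique he₁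
      rw [memAfter, ih, he.evalFuel_eq hn₁]
  have hout : ∀ h m n m', AtRound c P h m → Exec c m n m' →
        ∀ u : Fin P.U, (progLearner f c P h u : ℕ) = m'.nat 1 u := by
    intro h m n m' hm he u
    obtain ⟨n₁, m₁, he₁, hn₁, hu⟩ := hc _ _ hm
    obtain ⟨rfl, rfl⟩ := he.unique he₁
    simp only [progLearner, hmem h m hm, he.evalFuel_eq hn₁]
    -- The reduction modulo `P.K` in `progLearner` only serves to land in `Fin P.K`; it does not
    -- change an output that is already an arm.
    exact Nat.mod_eq_of_lt (hu u u.2)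
  refine ⟨fun h m _ hm => ?_, hout⟩
  obtain ⟨n₁, m₁, he₁, hn₁, -⟩ := hc _ _ hm
  exact ⟨n₁, m₁, he₁, hn₁, fun u => (hout h m n₁ m₁ hm he₁ u).symm⟩

/-! ### Weakest preconditions -/

/-- Started in `m`, the program halts, and the number of steps and the final memory satisfy `Q`. -/
def WP (c : Prog) (m : Mem) (Q : ℕ → Mem → Prop) : Prop := ∃ n m', Exec c m n m' ∧ Q n m'

theorem WP.mono {c : Prog} {m : Mem} {Q R : ℕ → Mem → Prop} (h : WP c m Q)
    (hQR : ∀ n m', Q n m' → R n m') : WP c m R :=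
  let ⟨n, m', he, hq⟩ := h
  ⟨n, m', he, hQR n m' hq⟩

theorem wp_skip {m : Mem} {Q : ℕ → Mem → Prop} (h : Q 1 m) : WP .skip m Q :=
  ⟨_, _, .skip m, h⟩

theorem wp_setNat {a : ℕ} {i e : NExp} {m : Mem} {Q : ℕ → Mem → Prop}
    (h : Q (i.steps + e.steps + 1) (m.setNat a (i.eval m) (e.eval m))) : WP (.setNat a i e) m Q :=
  ⟨_, _, .setNat a i e m, h⟩

theorem wp_setReal {a : ℕ} {i : NExp} {e : RExp} {m : Mem} {Q : ℕ → Mem → Prop}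
    (h : Q (i.steps + e.steps + 1) (m.setReal a (i.eval m) (e.eval m))) :
    WP (.setReal a i e) m Q :=
  ⟨_, _, .setReal a i e m, h⟩

theorem wp_seq {c₁ c₂ : Prog} {m : Mem} {Q : ℕ → Mem → Prop}
    (h : WP c₁ m fun n₁ m₁ => WP c₂ m₁ fun n₂ m₂ => Q (n₁ + n₂ + 1) m₂) :
    WP (.seq c₁ c₂) m Q :=
  let ⟨_, _, he₁, _, _, he₂, hq⟩ := h
  ⟨_, _, .seq he₁ he₂, hq⟩

theorem wp_cond {b : Test} {c₁ c₂ : Prog} {m : Mem} {Q : ℕ → Mem → Prop}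
    (h₁ : b.holds m → WP c₁ m fun n m' => Q (b.steps + n + 1) m')
    (h₂ : ¬ b.holds m → WP c₂ m fun n m' => Q (b.steps + n + 1) m') :
    WP (.cond b c₁ c₂) m Q := by
  by_cases hb : b.holds m
  · obtain ⟨n, m', he, hq⟩ := h₁ hb
    exact ⟨_, _, .condTrue hb he, hq⟩
  · obtain ⟨n, m', he, hq⟩ := h₂ hb
    exact ⟨_, _, .condFalse hb he, hq⟩

/-- Cell `0` of an array of naturals, used as a variable. -/
abbrev nvar (a : ℕ) : NExp := .get a (.lit 0)

/-- Cell `0` of an array of reals, used as a variable. -/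
abbrev rvar (a : ℕ) : RExp := .get a (.lit 0)

/-- Run `c` with the variable `v` running through the numbers below the parameter `p`. -/
def forLoop (v p : ℕ) (c : Prog) : Prog :=
  .seq (.setNat v (.lit 0) (.lit 0))
    (.loop (.neg (.natLe (.get 0 (.lit p)) (nvar v)))
      (.seq c (.setNat v (.lit 0) (.add (nvar v) (.lit 1)))))

/-- The rule for counting loops. -/
theorem wp_forLoop {v p : ℕ} {c : Prog} {m : Mem} {N τ : ℕ} (Inv : ℕ → Mem → Prop) (hv : v ≠ 0)
    (hN : m.nat 0 p = N) (h0 : Inv 0 (m.setNat v 0 0))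
    (hstep : ∀ i < N, ∀ m', m'.nat v 0 = i → m'.nat 0 p = N → Inv i m' →
      WP c m' fun n m'' => n ≤ τ ∧ m''.nat v 0 = i ∧ m''.nat 0 p = N ∧
        Inv (i + 1) (m''.setNat v 0 (i + 1)))
    {Q : ℕ → Mem → Prop}
    (hQ : ∀ n m', n ≤ N * (τ + 14) + 11 → m'.nat v 0 = N → m'.nat 0 p = N → Inv N m' → Q n m') :
    WP (forLoop v p c) m Q := by
  -- Induction on the number `d` of remaining iterations. Besides the body, an iteration costs 6
  -- steps for the test, 7 for the increment and its sequencing, and 1 for the loop: 14 in all. The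
  -- final failing test costs 7, and the initialization adds 4.
  have main : ∀ d i m', i + d = N → m'.nat v 0 = i → m'.nat 0 p = N → Inv i m' →
      WP (.loop (.neg (.natLe (.get 0 (.lit p)) (nvar v)))
        (.seq c (.setNat v (.lit 0) (.add (nvar v) (.lit 1))))) m'
        fun n m'' => n ≤ d * (τ + 14) + 7 ∧ m''.nat v 0 = N ∧ m''.nat 0 p = N ∧ Inv N m'' := by
    intro d
    induction d with
    | zero =>
      intro i m' hi hv' hp' hI
      obtain rfl : i = N := by omega
      refine ⟨_, _, .loopStop ?_, ?_, hv', hp', hI⟩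
      · simp [Test.holds, NExp.eval, hv', hp']
      · simp [Test.steps, NExp.steps]
    | succ d ih =>
      intro i m' hi hv' hp' hI
      obtain ⟨n₁, m₁, he₁, hn₁, hv₁, hp₁, hI₁⟩ := hstep i (by omega) m' hv' hp' hI
      obtain ⟨n₂, m₂, he₂, hn₂, hQ₂⟩ := ih (i + 1) (m₁.setNat v 0 (i + 1)) (by omega)
        (by simp [Mem.setNat]) (by simp [Mem.setNat, Function.update_of_ne hv.symm, hp₁]) hI₁
      refine ⟨_, _, .loopStep (n₂ := n₂) ?_ (.seq he₁ (.setNat v _ _ _)) ?_, ?_, hQ₂⟩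
      · simp [Test.holds, NExp.eval, hv', hp']; omega
      · simpa [NExp.eval, hv₁] using he₂
      · simp only [Test.steps, NExp.steps]
        ring_nf at hn₂ ⊢
        omega
  refine wp_seq (wp_setNat ((main N 0 (m.setNat v 0 0) (by omega) (by simp [Mem.setNat])
    (by simp [Mem.setNat, Function.update_of_ne hv.symm, hN]) h0).mono ?_))
  rintro n m' ⟨hn, h₁, h₂, h₃⟩
  refine hQ _ _ ?_ h₁ h₂ h₃
  simp only [NExp.steps]
  omega

end RealRAM

/-! ### The greedy algorithm with augmentation

Users and arms are natural numbers here; `w u k` is the (nonnegative) weight of arm `k` for user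
`u`, and `c k` the cost of arm `k`. -/

namespace GreedyMax

open Finset

section

variable (U K : ℕ) (w : ℕ → ℕ → ℝ) (c : ℕ → ℝ) (B : ℝ)

/-- A matching of the users below `U` to arms below `K` whose cost is at most `B`. -/
structure Feas (π : ℕ → ℕ) : Prop where
  lt : ∀ u < U, π u < K
  cost : ∑ k ∈ (range U).image π, c k ≤ B

/-- The value of a matching. -/
def val (π : ℕ → ℕ) : ℝ := ∑ u ∈ range U, w u (π u)

/-- The gain of adding arm `k` if user `u` has value `cur u`. -/
def gain (cur : ℕ → ℝ) (k : ℕ) : ℝ := ∑ u ∈ range U, max 0 (w u k - cur u)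

/-- The state of the greedy algorithm after `j` steps, apart from the best matching so far: `G` is
the set of chosen arms, `cG` its cost, `fG` its value, `cur u` the value of user `u`, attained at
`arm u`. -/
structure Chosen (G : Finset ℕ) (cur : ℕ → ℝ) (arm : ℕ → ℕ) (cG fG : ℝ) : Prop where
  cur_nonneg : ∀ u < U, 0 ≤ cur u
  sum_cur : fG = ∑ u ∈ range U, cur u
  subset : G ⊆ range K
  cost_le : ∑ k ∈ G, c k ≤ cG
  le_budget : cG ≤ B
  le_cur : ∀ k ∈ G, ∀ u < U, w u k ≤ cur u
  attained : ∀ u < U, cur u = 0 ∨ arm u ∈ G ∧ cur u = w u (arm u)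

/-- The invariant of the greedy algorithm after `j` steps. -/
structure Inv (j : ℕ) (G : Finset ℕ) (cur : ℕ → ℝ) (arm out : ℕ → ℕ) (cG fG best : ℝ) : Prop where
  chosen : Chosen U K w c B G cur arm cG fG
  le_best : fG ≤ best
  feas : Feas U K c B out
  best_le : best ≤ val U w out
  progress : ∀ π, Feas U K c B π → ∀ o ∈ (range U).image π, (∀ k ∈ (range U).image π, c k ≤ c o) →
    val U w π ≤ 2 * best ∨
      (#G = j ∧ val U w π * cG ≤ 2 * fG * (B - c o) ∧ cG ≤ B - c o)

/-- The invariant of the scan of all arms within one step, after `i` arms. -/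
structure Scan (cur : ℕ → ℝ) (cG fG best₀ : ℝ) (i : ℕ) (out : ℕ → ℕ) (bk : ℕ)
    (best dens bgain : ℝ) : Prop where
  feas : Feas U K c B out
  best_le : best ≤ val U w out
  best_mono : best₀ ≤ best
  best_ge : ∀ k < i, c k + cG ≤ B → fG + gain U w cur k ≤ best
  dens_ge : ∀ k < i, c k + cG ≤ B → gain U w cur k ≤ dens * c k
  dens_nonneg : 0 ≤ dens
  dens_eq : dens = 0 ∨ (bk < K ∧ c bk + cG ≤ B ∧ bgain = gain U w cur bk ∧ dens = bgain / c bk)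

end

variable {U K : ℕ} {w : ℕ → ℕ → ℝ} {c : ℕ → ℝ} {B : ℝ}

theorem Feas.congr {π σ : ℕ → ℕ} (h : Feas U K c B π) (hσ : ∀ u < U, σ u = π u) :
    Feas U K c B σ where
  lt u hu := hσ u hu ▸ h.lt u hu
  cost := by
    rw [image_congr (g := π) fun u hu => hσ u (by simpa using hu)]
    exact h.cost

theorem val_congr {π σ : ℕ → ℕ} (hσ : ∀ u < U, σ u = π u) : val U w σ = val U w π :=
  sum_congr rfl fun u hu => by rw [hσ u (mem_range.1 hu)]

theorem val_nonneg (hw : ∀ u < U, ∀ k < K, 0 ≤ w u k) {π : ℕ → ℕ} (h : ∀ u < U, π u < K) :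
    0 ≤ val U w π :=
  sum_nonneg fun u hu => hw u (mem_range.1 hu) _ (h u (mem_range.1 hu))

/-- The value of a matching is bounded by the gains of its arms. -/
theorem val_le (cur : ℕ → ℝ) (π : ℕ → ℕ) :
    val U w π ≤ ∑ u ∈ range U, cur u + ∑ k ∈ (range U).image π, gain U w cur k := by
  unfold gain val
  rw [sum_comm, ← sum_add_distrib]
  refine sum_le_sum fun u hu => ?_
  -- This plays the role of submodularity: the improvement of `u` under `π` is one of the
  -- nonnegative terms of the sum of gains.
  have h₁ : max 0 (w u (π u) - cur u) ≤ ∑ k ∈ (range U).image π, max 0 (w u k - cur u) :=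
    single_le_sum (f := fun k => max 0 (w u k - cur u)) (fun _ _ => le_max_left _ _)
      (mem_image_of_mem π hu)
  have h₂ := le_max_right 0 (w u (π u) - cur u)
  linarith

/-! ### Analysis of one step of the greedy algorithm -/

section Step

variable {G : Finset ℕ} {cur : ℕ → ℝ} {arm : ℕ → ℕ} {cG fG : ℝ}

/-- The matching obtained by adding one arm. -/
theorem Chosen.candidate (h : Chosen U K w c B G cur arm cG fG) (hc : ∀ k < K, 0 < c k)
    (hw : ∀ u < U, ∀ k < K, 0 ≤ w u k) {k : ℕ} (hk : k < K) (hB : c k + cG ≤ B) {out : ℕ → ℕ}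
    (hout : ∀ u < U, out u = if cur u ≤ w u k then k else arm u) :
    Feas U K c B out ∧ fG + gain U w cur k ≤ val U w out := by
  have hmem : ∀ u < U, out u ∈ insert k G ∧ cur u + max 0 (w u k - cur u) ≤ w u (out u) := by
    intro u hu
    rw [hout u hu]
    split_ifs with hle
    · exact ⟨mem_insert_self _ _, by rw [max_eq_right (by linarith)]; linarith⟩
    -- A user that does not switch has `cur u > w u k ≥ 0`, so its stored arm is genuine. This is
    -- why ties are resolved by switching: a user of value `0` may have no valid arm yet.
    · rcases h.attained u hu with h0 | ⟨hG, heq⟩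
      · exact absurd (h0 ▸ hw u hu k hk) hle
      · exact ⟨mem_insert_of_mem hG, by rw [max_eq_left (by linarith)]; linarith⟩
  have hsub : insert k G ⊆ range K := insert_subset (mem_range.2 hk) h.subset
  refine ⟨⟨fun u hu => mem_range.1 (hsub (hmem u hu).1), ?_⟩, ?_⟩
  · calc ∑ k ∈ (range U).image out, c k ≤ ∑ k ∈ insert k G, c k := by
          refine sum_le_sum_of_subset_of_nonneg ?_
            fun i hi _ => (hc i (mem_range.1 (hsub hi))).le
          intro i hi
          obtain ⟨u, hu, rfl⟩ := mem_image.1 hi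
          exact (hmem u (mem_range.1 hu)).1
      _ ≤ c k + ∑ k ∈ G, c k := by
          by_cases hkG : k ∈ G
          · rw [insert_eq_of_mem hkG]
            linarith [hc k hk]
          · rw [sum_insert hkG]
      _ ≤ B := by linarith [h.cost_le]
  · rw [h.sum_cur, gain, ← sum_add_distrib]
    exact sum_le_sum fun u hu => (hmem u (mem_range.1 hu)).2

/-- The arm may already belong to `G`; then its cost is charged a second time. For this reason
`Chosen` bounds the cost of `G` by `cG` without asking for equality. -/
theorem Chosen.insert (h : Chosen U K w c B G cur arm cG fG) (hc : ∀ k < K, 0 < c k)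
    (hw : ∀ u < U, ∀ k < K, 0 ≤ w u k) {k : ℕ} (hk : k < K) (hB : c k + cG ≤ B)
    {cur' : ℕ → ℝ} {arm' : ℕ → ℕ}
    (hcur : ∀ u < U, cur' u = if cur u ≤ w u k then w u k else cur u)
    (harm : ∀ u < U, arm' u = if cur u ≤ w u k then k else arm u) :
    Chosen U K w c B (insert k G) cur' arm' (cG + c k) (fG + gain U w cur k) where
  cur_nonneg u hu := by
    rw [hcur u hu]
    split_ifs
    exacts [hw u hu k hk, h.cur_nonneg u hu]
  sum_cur := by
    rw [h.sum_cur, gain, ← sum_add_distrib]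
    refine sum_congr rfl fun u hu => ?_
    rw [hcur u (mem_range.1 hu)]
    split_ifs with hle
    · rw [max_eq_right (by linarith)]; ring
    · rw [max_eq_left (by linarith)]; ring
  subset := insert_subset (mem_range.2 hk) h.subset
  cost_le := by
    by_cases hkG : k ∈ G
    · rw [insert_eq_of_mem hkG]
      linarith [hc k hk, h.cost_le]
    · rw [sum_insert hkG]
      linarith [h.cost_le]
  le_budget := by linarith
  le_cur i hi u hu := by
    rw [hcur u hu]
    rcases mem_insert.1 hi with rfl | hi
    · split_ifs with hle
      exacts [le_rfl, (not_le.1 hle).le]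
    · have := h.le_cur i hi u hu
      split_ifs with hle
      exacts [this.trans hle, this]
  attained u hu := by
    rw [hcur u hu, harm u hu]
    split_ifs
    · exact .inr ⟨mem_insert_self _ _, rfl⟩
    · exact (h.attained u hu).imp_right fun h => ⟨mem_insert_of_mem h.1, h.2⟩

variable {out₀ out : ℕ → ℕ} {bk j : ℕ} {best₀ best dens bgain : ℝ}

theorem Inv.scan_zero (h : Inv U K w c B j G cur arm out cG fG best) :
    Scan U K w c B cur cG fG best 0 out bk best 0 bgain where
  feas := h.feas
  best_le := h.best_le
  best_mono := le_rfl
  best_ge := by simp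
  dens_ge := by simp
  dens_nonneg := le_rfl
  dens_eq := .inl rfl

/-- An arm that does not fit is skipped. -/
theorem Scan.skip {i : ℕ} (h : Scan U K w c B cur cG fG best₀ i out bk best dens bgain)
    (hB : ¬ c i + cG ≤ B) : Scan U K w c B cur cG fG best₀ (i + 1) out bk best dens bgain where
  feas := h.feas
  best_le := h.best_le
  best_mono := h.best_mono
  best_ge k hk hkB := by
    rcases Nat.lt_succ_iff_lt_or_eq.1 hk with hk | rfl
    exacts [h.best_ge k hk hkB, absurd hkB hB]
  dens_ge k hk hkB := by
    rcases Nat.lt_succ_iff_lt_or_eq.1 hk with hk | rfl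
    exacts [h.dens_ge k hk hkB, absurd hkB hB]
  dens_nonneg := h.dens_nonneg
  dens_eq := h.dens_eq

/-- The hypotheses `h₁` to `h₄` are the outcomes of two independent conditional updates, of the best
matching and of the densest arm. Earlier inequalities survive since `best` and `dens` never decrease
and costs are positive. -/
theorem Scan.next {i : ℕ} (h : Scan U K w c B cur cG fG best₀ i out bk best dens bgain)
    (hch : Chosen U K w c B G cur arm cG fG) (hc : ∀ k < K, 0 < c k)
    (hw : ∀ u < U, ∀ k < K, 0 ≤ w u k) (hi : i < K) (hB : c i + cG ≤ B)
    {out' : ℕ → ℕ} {bk' : ℕ} {best' dens' bgain' : ℝ}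
    (h₁ : best < fG + gain U w cur i → best' = fG + gain U w cur i ∧
      ∀ u < U, out' u = if cur u ≤ w u i then i else arm u)
    (h₂ : ¬ best < fG + gain U w cur i → best' = best ∧ ∀ u < U, out' u = out u)
    (h₃ : dens < gain U w cur i / c i →
      dens' = gain U w cur i / c i ∧ bgain' = gain U w cur i ∧ bk' = i)
    (h₄ : ¬ dens < gain U w cur i / c i → dens' = dens ∧ bgain' = bgain ∧ bk' = bk) :
    Scan U K w c B cur cG fG best₀ (i + 1) out' bk' best' dens' bgain' := by
  have hbest : Feas U K c B out' ∧ best' ≤ val U w out' ∧ best ≤ best' ∧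
      fG + gain U w cur i ≤ best' := by
    by_cases hb : best < fG + gain U w cur i
    · obtain ⟨rfl, ho⟩ := h₁ hb
      obtain ⟨hf, hv⟩ := hch.candidate hc hw hi hB ho
      exact ⟨hf, hv, hb.le, le_rfl⟩
    · obtain ⟨rfl, ho⟩ := h₂ hb
      exact ⟨h.feas.congr ho, by rw [val_congr ho]; exact h.best_le, le_rfl, not_lt.1 hb⟩
  have hdens : dens ≤ dens' ∧ gain U w cur i ≤ dens' * c i ∧ (dens' = 0 ∨
      (bk' < K ∧ c bk' + cG ≤ B ∧ bgain' = gain U w cur bk' ∧ dens' = bgain' / c bk')) := by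
    by_cases hd : dens < gain U w cur i / c i
    · obtain ⟨rfl, rfl, rfl⟩ := h₃ hd
      refine ⟨hd.le, ?_, .inr ⟨hi, hB, rfl, rfl⟩⟩
      rw [div_mul_cancel₀ _ (hc _ hi).ne']
    · obtain ⟨rfl, rfl, rfl⟩ := h₄ hd
      exact ⟨le_rfl, (div_le_iff₀ (hc i hi)).1 (not_lt.1 hd), h.dens_eq⟩
  obtain ⟨hf, hv, hm, hg⟩ := hbest
  obtain ⟨hdm, hdg, hde⟩ := hdens
  refine ⟨hf, hv, h.best_mono.trans hm, fun k hk hkB => ?_, fun k hk hkB => ?_,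
    h.dens_nonneg.trans hdm, hde⟩
  · rcases Nat.lt_succ_iff_lt_or_eq.1 hk with hk | rfl
    exacts [(h.best_ge k hk hkB).trans hm, hg]
  · rcases Nat.lt_succ_iff_lt_or_eq.1 hk with hk' | rfl
    · refine (h.dens_ge k hk' hkB).trans ?_
      exact mul_le_mul_of_nonneg_right hdm (hc k (by omega)).le
    · exact hdg

/-- As long as the best candidate has less than half of the value of a matching, the density of
the greedy choice is large. -/
theorem Scan.lt_dens (h : Scan U K w c B cur cG fG best₀ K out bk best dens bgain)
    (hch : Chosen U K w c B G cur arm cG fG)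
    {π : ℕ → ℕ} (hπ : Feas U K c B π) {o : ℕ} (ho : o ∈ (range U).image π)
    (hmax : ∀ k ∈ (range U).image π, c k ≤ c o) (hcG : cG ≤ B - c o)
    (hlt : 2 * best < val U w π) : val U w π < 2 * dens * (B - c o) := by
  -- There is room left for `o`, the most expensive arm of `π`, hence for each arm of `π`.
  have hfit : ∀ k ∈ (range U).image π, k < K ∧ c k + cG ≤ B := by
    intro k hk
    refine ⟨?_, by linarith [hmax k hk]⟩
    obtain ⟨u, hu, rfl⟩ := mem_image.1 hk
    exact hπ.lt u (mem_range.1 hu)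
  have h₁ := val_le (U := U) (w := w) cur π
  -- The arm `o` is split off: `fG + gain o` is at most `best`, being the value bound of a
  -- candidate, and the remaining arms cost at most `B - c o`, so their gains sum to at most `dens *
  -- (B - c o)`.
  rw [← hch.sum_cur, ← add_sum_erase _ _ ho] at h₁
  have h₂ : ∑ k ∈ ((range U).image π).erase o, gain U w cur k ≤
      dens * ∑ k ∈ ((range U).image π).erase o, c k := by
    rw [mul_sum]
    refine sum_le_sum fun k hk => ?_
    obtain ⟨hk, hkB⟩ := hfit k (mem_of_mem_erase hk)
    exact h.dens_ge k hk hkB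
  have h₃ : ∑ k ∈ ((range U).image π).erase o, c k ≤ B - c o := by
    have := hπ.cost
    rw [← add_sum_erase _ _ ho] at this
    linarith
  have h₄ := mul_le_mul_of_nonneg_left h₃ h.dens_nonneg
  have h₅ := h.best_ge o (hfit o ho).1 (hfit o ho).2
  linarith

/-- Adding an arm whose density exceeds `val π / (2 * (B - c o))` preserves `val π * cG ≤ 2 * fG *
(B - c o)`. If the new cost exceeds `B - c o`, this inequality forces half of `val π` to be reached.
-/
theorem Inv.step (h : Inv U K w c B j G cur arm out₀ cG fG best₀)
    (hs : Scan U K w c B cur cG fG best₀ K out bk best dens bgain) (hc : ∀ k < K, 0 < c k)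
    (hw : ∀ u < U, ∀ k < K, 0 ≤ w u k) (hd : 0 < dens) {cur' : ℕ → ℝ} {arm' : ℕ → ℕ}
    (hcur : ∀ u < U, cur' u = if cur u ≤ w u bk then w u bk else cur u)
    (harm : ∀ u < U, arm' u = if cur u ≤ w u bk then bk else arm u) :
    Inv U K w c B (j + 1) (insert bk G) cur' arm' out (cG + c bk) (fG + bgain) best := by
  obtain ⟨hbk, hbB, rfl, hdeq⟩ := hs.dens_eq.resolve_left hd.ne'
  have hgain : gain U w cur bk = dens * c bk := by
    rw [hdeq, div_mul_cancel₀ _ (hc _ hbk).ne']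
  have hle := hs.best_ge bk hbk hbB
  refine ⟨h.chosen.insert hc hw hbk hbB hcur harm, hle, hs.feas, hs.best_le, ?_⟩
  intro π hπ o ho hmax
  by_contra! hcon
  obtain ⟨hlt, hcon⟩ := hcon
  rcases h.progress π hπ o ho hmax with hdone | ⟨hcard, hval, hcG⟩
  · linarith [hs.best_mono]
  have hdens := hs.lt_dens h.chosen hπ ho hmax hcG hlt
  have hval' : val U w π * (cG + c bk) ≤ 2 * (fG + gain U w cur bk) * (B - c o) := by
    have := mul_le_mul_of_nonneg_right hdens.le (hc bk hbk).le
    rw [hgain]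
    linarith
  -- Arms of `G` have gain `0`, whereas positive density means positive gain. Thus `G` really grows,
  -- which keeps `#G` equal to the step count.
  have hnot : bk ∉ G := by
    intro hmem
    have : gain U w cur bk = 0 := sum_eq_zero fun u hu =>
      max_eq_left (by linarith [h.chosen.le_cur bk hmem u (mem_range.1 hu)])
    have hpos := mul_pos hd (hc bk hbk)
    linarith
  have hvpos : 0 < val U w π := by
    have h₀ : 0 ≤ fG := h.chosen.sum_cur ▸ sum_nonneg fun u hu =>
      h.chosen.cur_nonneg u (mem_range.1 hu)
    linarith [h.le_best, hs.best_mono]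
  have hBo : 0 < B - c o := by
    by_contra! hneg
    have := mul_nonpos_of_nonneg_of_nonpos (by linarith : 0 ≤ 2 * dens) hneg
    linarith
  -- Under the assumption that the progress clause fails, the budget part must be what fails: the
  -- new cost exceeds `B - c o`. With `hval'` and `2 * best < val π` this bounds `val π * (B - c o)`
  -- strictly by itself.
  have hfin := hcon (by rw [card_insert_of_notMem hnot, hcard]) hval'
  have h₁ : 2 * (fG + gain U w cur bk) * (B - c o) ≤ val U w π * (B - c o) :=
    mul_le_mul_of_nonneg_right (by linarith) hBo.le
  have h₂ := mul_lt_mul_of_pos_left hfin hvpos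
  linarith

/-- If no fitting arm has positive density, `Scan.lt_dens` with `dens = 0` would make the value of
`π` negative. So every `π` is already within the factor two. -/
theorem Inv.stay (h : Inv U K w c B j G cur arm out₀ cG fG best₀)
    (hs : Scan U K w c B cur cG fG best₀ K out bk best dens bgain)
    (hw : ∀ u < U, ∀ k < K, 0 ≤ w u k) (hd : ¬ 0 < dens) :
    Inv U K w c B (j + 1) G cur arm out cG fG best := by
  refine ⟨h.chosen, h.le_best.trans hs.best_mono, hs.feas, hs.best_le, ?_⟩
  intro π hπ o ho hmax
  refine .inl ?_
  by_contra! hlt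
  rcases h.progress π hπ o ho hmax with hdone | ⟨hcard, hval, hcG⟩
  · linarith [hs.best_mono]
  have hdens := hs.lt_dens h.chosen hπ ho hmax hcG hlt
  obtain rfl : dens = 0 := le_antisymm (not_lt.1 hd) hs.dens_nonneg
  have := val_nonneg hw hπ.lt
  linarith

theorem inv_zero (hK : 0 < K) (hc : ∀ k < K, 0 < c k) (hcB : ∀ k < K, c k ≤ B)
    (hw : ∀ u < U, ∀ k < K, 0 ≤ w u k)
    (hcur : ∀ u < U, cur u = 0) (hout : ∀ u < U, out u = 0) :
    Inv U K w c B 0 ∅ cur arm out 0 0 0 where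
  chosen :=
    { cur_nonneg := fun u hu => (hcur u hu).ge
      sum_cur := (sum_eq_zero fun u hu => hcur u (mem_range.1 hu)).symm
      subset := empty_subset _
      cost_le := by simp
      le_budget := (hc 0 hK).le.trans (hcB 0 hK)
      le_cur := by simp
      attained := fun u hu => .inl (hcur u hu) }
  le_best := le_rfl
  feas := by
    refine ⟨fun u hu => (hout u hu).symm ▸ hK, ?_⟩
    calc ∑ k ∈ (range U).image out, c k ≤ ∑ k ∈ {0}, c k := by
          refine sum_le_sum_of_subset_of_nonneg ?_ fun i hi _ => by
            rw [mem_singleton.1 hi]; exact (hc 0 hK).le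
          intro i hi
          obtain ⟨u, hu, rfl⟩ := mem_image.1 hi
          simpa using hout u (mem_range.1 hu)
      _ ≤ B := by simpa using hcB 0 hK
  best_le := val_nonneg hw fun u hu => (hout u hu).symm ▸ hK
  progress π hπ o ho hmax := by
    refine .inr ⟨rfl, by simp, ?_⟩
    obtain ⟨u, hu, rfl⟩ := mem_image.1 ho
    linarith [hcB _ (hπ.lt u (mem_range.1 hu))]

/-- After `K` steps the best matching has at least half of the value of every feasible matching. -/
theorem Inv.half_le (h : Inv U K w c B K G cur arm out cG fG best) (hU : 0 < U)
    (hw : ∀ u < U, ∀ k < K, 0 ≤ w u k) {π : ℕ → ℕ} (hπ : Feas U K c B π) :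
    val U w π ≤ 2 * val U w out := by
  obtain ⟨o, ho, hmax⟩ := exists_max_image ((range U).image π) c
    ((nonempty_range_iff.2 hU.ne').image π)
  rcases h.progress π hπ o ho hmax with hle | ⟨hcard, -, -⟩
  · linarith [h.best_le]
  -- `K` distinct arms are all arms, so `cur u` dominates every weight of `u` and `fG` dominates
  -- every matching.
  · have hG : G = range K := eq_of_subset_of_card_le h.chosen.subset (by simp [hcard])
    have h₁ : val U w π ≤ fG := h.chosen.sum_cur ▸ sum_le_sum fun u hu =>
      h.chosen.le_cur _ (hG ▸ mem_range.2 (hπ.lt u (mem_range.1 hu))) u (mem_range.1 hu)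
    have := val_nonneg hw hπ.lt
    linarith [h.le_best, h.best_le]

end Step

end GreedyMax

namespace RealRAM

/-! ### The program -/

/-- The real constant `0`. -/
abbrev rzero : RExp := .ofNat (.lit 0)

/-- The test `e₁ < e₂`. -/
abbrev Test.realLt (e₁ e₂ : RExp) : Test := .neg (.realLe e₂ e₁)

/-- The weight of the current user (variable `9`) and the arm whose row starts at the cell stored
in the variable `b`. -/
abbrev weightAt (b : ℕ) : RExp := .get 2 (.add (nvar b) (nvar 9))

/-- The value of the current user (variable `9`). -/
abbrev curAt : RExp := .get 3 (nvar 9)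

/-- Add the positive parts of the last observations to the weights of the current arm. -/
def recordP : Prog :=
  forLoop 9 1 (.cond (.realLe rzero (.get 1 (nvar 9)))
    (.setReal 2 (.add (nvar 4) (nvar 9)) (.add (weightAt 4) (.get 1 (nvar 9)))) .skip)

/-- Move on to the next arm. -/
def advanceP : Prog :=
  .seq (.setNat 3 (.lit 0) (.add (nvar 3) (.lit 1)))
    (.seq (.setNat 4 (.lit 0) (.add (nvar 4) (.get 0 (.lit 1))))
      (.cond (.natLe (.get 0 (.lit 2)) (nvar 3))
        (.seq (.setNat 3 (.lit 0) (.lit 0))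
          (.seq (.setNat 4 (.lit 0) (.lit 0)) (.setNat 5 (.lit 0) (.add (nvar 5) (.lit 1)))))
        .skip))

/-- Every user is matched to the current arm. -/
def fillP : Prog := forLoop 9 1 (.setNat 1 (nvar 9) (nvar 3))

/-- The initialization of the greedy algorithm. -/
def initP : Prog :=
  .seq (.setReal 4 (.lit 0) rzero) (.seq (.setReal 5 (.lit 0) rzero)
    (.seq (.setReal 8 (.lit 0) rzero)
      (forLoop 9 1 (.seq (.setReal 3 (nvar 9) rzero) (.setNat 1 (nvar 9) (.lit 0))))))

/-- Compute the gain of the scanned arm. -/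
def gainP : Prog :=
  .seq (.setReal 6 (.lit 0) rzero)
    (forLoop 9 1 (.cond (.realLe curAt (weightAt 8))
      (.setReal 6 (.lit 0) (.add (rvar 6) (.sub (weightAt 8) curAt))) .skip))

/-- Store the matching that is obtained by adding the scanned arm. -/
def storeP : Prog :=
  forLoop 9 1 (.cond (.realLe curAt (weightAt 8))
    (.setNat 1 (nvar 9) (nvar 7)) (.setNat 1 (nvar 9) (.get 2 (nvar 9))))

/-- Update the best matching. -/
def updateBestP : Prog :=
  .cond (.realLt (rvar 8) (.add (rvar 5) (rvar 6)))
    (.seq (.setReal 8 (.lit 0) (.add (rvar 5) (rvar 6))) storeP) .skip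

/-- Update the arm of maximal density. -/
def updateDensP : Prog :=
  .cond (.realLt (rvar 7) (.div (rvar 6) (.get 0 (nvar 7))))
    (.seq (.setReal 7 (.lit 0) (.div (rvar 6) (.get 0 (nvar 7))))
      (.seq (.setReal 9 (.lit 0) (rvar 6))
        (.seq (.setNat 10 (.lit 0) (nvar 7)) (.setNat 11 (.lit 0) (nvar 8)))))
    .skip

/-- Process one arm in a scan of all arms. -/
def scanBodyP : Prog :=
  .seq (.cond (.realLe (.add (.get 0 (nvar 7)) (rvar 4)) (.ofNat (.get 0 (.lit 3))))
      (.seq gainP (.seq updateBestP updateDensP)) .skip)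
    (.setNat 8 (.lit 0) (.add (nvar 8) (.get 0 (.lit 1))))

/-- Scan all arms. -/
def scanP : Prog :=
  .seq (.setReal 7 (.lit 0) rzero) (.seq (.setNat 8 (.lit 0) (.lit 0)) (forLoop 7 2 scanBodyP))

/-- Replace the values and arms of the users that profit from the greedy choice. -/
def switchP : Prog :=
  forLoop 9 1 (.cond (.realLe curAt (weightAt 11))
    (.seq (.setReal 3 (nvar 9) (weightAt 11)) (.setNat 2 (nvar 9) (nvar 10))) .skip)

/-- Add the greedy choice. -/
def addP : Prog :=
  .cond (.realLt rzero (rvar 7))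
    (.seq (.setReal 4 (.lit 0) (.add (rvar 4) (.get 0 (nvar 10))))
      (.seq (.setReal 5 (.lit 0) (.add (rvar 5) (rvar 9))) switchP))
    .skip

/-- The greedy algorithm. -/
def greedyP : Prog := .seq initP (forLoop 6 2 (.seq scanP addP))

/-- The test whether the exploration goes on. -/
def exploring : Test :=
  .realLt (.mul (.mul (.ofNat (nvar 5)) (.ofNat (nvar 5))) (.ofNat (nvar 5)))
    (.mul (.ofNat (.get 0 (.lit 0))) (.ofNat (.get 0 (.lit 0))))

/-- The program: explore the arms in turn, then commit to the outcome of the greedy algorithm. -/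
def banditP : Prog :=
  .seq (.cond (.conj (.natLe (.lit 1) (nvar 12)) exploring) (.seq recordP advanceP)
      (.setNat 12 (.lit 0) (.lit 1)))
    (.cond exploring fillP greedyP)

/-! ### Specifications of the parts -/

@[simp] theorem Mem.setNat_nat (m : Mem) (a i v b j : ℕ) :
    (m.setNat a i v).nat b j = if b = a ∧ j = i then v else m.nat b j := by
  by_cases hb : b = a
  · subst hb; simp [Mem.setNat, Function.update_apply]
  · simp [Mem.setNat, hb]

@[simp] theorem Mem.setNat_real (m : Mem) (a i v : ℕ) : (m.setNat a i v).real = m.real := rfl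

@[simp] theorem Mem.setReal_real (m : Mem) (a i : ℕ) (v : ℝ) (b j : ℕ) :
    (m.setReal a i v).real b j = if b = a ∧ j = i then v else m.real b j := by
  by_cases hb : b = a
  · subst hb; simp [Mem.setReal, Function.update_apply]
  · simp [Mem.setReal, hb]

@[simp] theorem Mem.setReal_nat (m : Mem) (a i : ℕ) (v : ℝ) : (m.setReal a i v).nat = m.nat := rfl

/-- Memory layout. Naturals: `0` parameters, `1` output, `2` arms of the users in the greedy
algorithm, `3` explored arm, `4` its row offset, `5` completed sweeps, `6` greedy step, `7` scanned
arm, `8` its row offset, `9` user, `10` greedy choice, `11` its row offset, `12` flag of the first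
round. Reals: `0` costs, `1` observations, `2` weights, `3` values of the users, `4` `cG`, `5` `fG`,
`6` gain of the scanned arm, `7` best density, `8` best value, `9` gain of the greedy choice. Row
offsets are maintained by addition, since naturals cannot be multiplied in one step. -/
theorem wp_recordP {m : Mem} {U : ℕ} (hU : m.nat 0 1 = U) {Q : ℕ → Mem → Prop}
    (hQ : ∀ n m', n ≤ U * 40 + 20 →
      (∀ a j, m'.nat a j = if a = 9 ∧ j = 0 then U else m.nat a j) →
      (∀ a j, m'.real a j = if a = 2 ∧ m.nat 4 0 ≤ j ∧ j < m.nat 4 0 + U then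
        m.real 2 j + max 0 (m.real 1 (j - m.nat 4 0)) else m.real a j) → Q n m') :
    WP recordP m Q := by
  refine wp_forLoop (τ := 26) (fun i m' =>
    (∀ a j, m'.nat a j = if a = 9 ∧ j = 0 then i else m.nat a j) ∧
    (∀ a j, m'.real a j = if a = 2 ∧ m.nat 4 0 ≤ j ∧ j < m.nat 4 0 + i then
        m.real 2 j + max 0 (m.real 1 (j - m.nat 4 0)) else m.real a j))
    (by norm_num) hU ?_ ?_ ?_
  · refine ⟨by simp, fun a j => ?_⟩
    rw [if_neg (by omega)]; simp
  · rintro i hi m' hv hp ⟨hn, hr⟩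
    refine wp_cond (fun hb => wp_setReal ?_) (fun hb => wp_skip ?_)
    all_goals
      simp [Test.holds, RExp.eval, NExp.eval, hn, hr] at hb
      simp [Test.steps, RExp.steps, NExp.steps, NExp.eval, RExp.eval, hn, hr, hU]
      refine ⟨fun a j => by split_ifs <;> simp_all, fun a j => ?_⟩
      by_cases ha : a = 2
      swap
      · simp [ha]
      subst ha
      rcases lt_trichotomy j (m.nat 4 0 + i) with hj | rfl | hj
    · simp [hj.ne, hj, show j < m.nat 4 0 + (i + 1) by omega]
    · simp [hb]
    · simp [hj.ne', show ¬ j < m.nat 4 0 + (i + 1) by omega, show ¬ j < m.nat 4 0 + i by omega]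
    · simp [hj, show j < m.nat 4 0 + (i + 1) by omega]
    · simp [hb.le]
    · simp [show ¬ j < m.nat 4 0 + (i + 1) by omega, show ¬ j < m.nat 4 0 + i by omega]
  · rintro n m' h - - ⟨hn, hr⟩
    exact hQ n m' (by omega) hn hr

theorem wp_fillP {m : Mem} {U : ℕ} (hU : m.nat 0 1 = U) {Q : ℕ → Mem → Prop}
    (hQ : ∀ n m', n ≤ U * 20 + 20 →
      (∀ a j, m'.nat a j = if a = 9 ∧ j = 0 then U else if a = 1 ∧ j < U then m.nat 3 0
        else m.nat a j) →
      (∀ a j, m'.real a j = m.real a j) → Q n m') :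
    WP fillP m Q := by
  refine wp_forLoop (τ := 6) (fun i m' =>
    (∀ a j, m'.nat a j = if a = 9 ∧ j = 0 then i else if a = 1 ∧ j < i then m.nat 3 0
        else m.nat a j) ∧
    (∀ a j, m'.real a j = m.real a j))
    (by norm_num) hU ?_ ?_ ?_
  · exact ⟨fun a j => by simp, fun a j => rfl⟩
  · rintro i hi m' hv hp ⟨hn, hr⟩
    refine wp_setNat ?_
    simp [NExp.steps, NExp.eval, hn, hr, hU]
    intro a j
    split_ifs <;> first | rfl | omega
  · rintro n m' h - - ⟨hn, hr⟩
    exact hQ n m' (by omega) hn hr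

theorem wp_initP {m : Mem} {U : ℕ} (hU : m.nat 0 1 = U) {Q : ℕ → Mem → Prop}
    (hQ : ∀ n m', n ≤ U * 30 + 40 →
      (∀ a j, m'.nat a j = if a = 9 ∧ j = 0 then U else if a = 1 ∧ j < U then 0
        else m.nat a j) →
      (∀ a j, m'.real a j = if a = 3 ∧ j < U then 0 else if (a = 4 ∨ a = 5 ∨ a = 8) ∧ j = 0 then 0
        else m.real a j) → Q n m') :
    WP initP m Q := by
  refine wp_seq (wp_setReal (wp_seq (wp_setReal (wp_seq (wp_setReal ?_)))))
  refine wp_forLoop (τ := 12) (N := U) (fun i m' =>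
    (∀ a j, m'.nat a j = if a = 9 ∧ j = 0 then i else if a = 1 ∧ j < i then 0
        else m.nat a j) ∧
    (∀ a j, m'.real a j = if a = 3 ∧ j < i then 0 else
      if (a = 4 ∨ a = 5 ∨ a = 8) ∧ j = 0 then 0 else m.real a j))
    (by norm_num) (by simpa using hU) ?_ ?_ ?_
  · refine ⟨fun a j => by simp, fun a j => ?_⟩
    simp [NExp.eval, RExp.eval]
    split_ifs <;> first | rfl | omega
  · rintro i hi m' hv hp ⟨hn, hr⟩
    refine wp_seq (wp_setReal (wp_setNat ?_))
    simp [NExp.steps, NExp.eval, RExp.steps, RExp.eval, hn, hr, hU]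
    constructor <;> intro a j <;> split_ifs <;> first | rfl | omega
  · rintro n m' h - - ⟨hn, hr⟩
    refine hQ _ m' ?_ hn hr
    simp [NExp.steps, RExp.steps]
    omega

theorem wp_gainP {m : Mem} {U : ℕ} (hU : m.nat 0 1 = U) {Q : ℕ → Mem → Prop}
    (hQ : ∀ n m', n ≤ U * 60 + 40 →
      (∀ a j, m'.nat a j = if a = 9 ∧ j = 0 then U else m.nat a j) →
      (∀ a j, m'.real a j = if a = 6 ∧ j = 0 then
        ∑ u ∈ Finset.range U, max 0 (m.real 2 (m.nat 8 0 + u) - m.real 3 u)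
        else m.real a j) → Q n m') :
    WP gainP m Q := by
  refine wp_seq (wp_setReal ?_)
  refine wp_forLoop (τ := 40) (N := U) (fun i m' =>
    (∀ a j, m'.nat a j = if a = 9 ∧ j = 0 then i else m.nat a j) ∧
    (∀ a j, m'.real a j = if a = 6 ∧ j = 0 then
      ∑ u ∈ Finset.range i, max 0 (m.real 2 (m.nat 8 0 + u) - m.real 3 u) else m.real a j))
    (by norm_num) (by simpa using hU) ?_ ?_ ?_
  · exact ⟨fun a j => by simp, fun a j => by simp [NExp.eval, RExp.eval]⟩
  · rintro i hi m' hv hp ⟨hn, hr⟩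
    refine wp_cond (fun hb => wp_setReal ?_) (fun hb => wp_skip ?_)
    all_goals
      simp [Test.holds, RExp.eval, NExp.eval, hn, hr] at hb
      simp [Test.steps, RExp.steps, NExp.steps, NExp.eval, RExp.eval, hn, hr, hU]
      refine ⟨fun a j => by split_ifs <;> simp_all, fun a j => ?_⟩
      rw [Finset.sum_range_succ]
    · rw [max_eq_right (by linarith)]
      split_ifs <;> rfl
    · rw [max_eq_left (by linarith), add_zero]
  · rintro n m' h - - ⟨hn, hr⟩
    refine hQ _ m' ?_ hn hr
    simp [NExp.steps, RExp.steps]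
    omega

theorem wp_storeP {m : Mem} {U : ℕ} (hU : m.nat 0 1 = U) {Q : ℕ → Mem → Prop}
    (hQ : ∀ n m', n ≤ U * 40 + 20 →
      (∀ a j, m'.nat a j = if a = 9 ∧ j = 0 then U else if a = 1 ∧ j < U then
        (if m.real 3 j ≤ m.real 2 (m.nat 8 0 + j) then m.nat 7 0 else m.nat 2 j)
        else m.nat a j) →
      (∀ a j, m'.real a j = m.real a j) → Q n m') :
    WP storeP m Q := by
  refine wp_forLoop (τ := 26) (N := U) (fun i m' =>
    (∀ a j, m'.nat a j = if a = 9 ∧ j = 0 then i else if a = 1 ∧ j < i then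
        (if m.real 3 j ≤ m.real 2 (m.nat 8 0 + j) then m.nat 7 0 else m.nat 2 j)
        else m.nat a j) ∧
    (∀ a j, m'.real a j = m.real a j))
    (by norm_num) hU ?_ ?_ ?_
  · exact ⟨fun a j => by simp, fun a j => rfl⟩
  · rintro i hi m' hv hp ⟨hn, hr⟩
    refine wp_cond (fun hb => wp_setNat ?_) (fun hb => wp_setNat ?_)
    all_goals
      simp [Test.holds, RExp.eval, NExp.eval, hn, hr] at hb
      simp [Test.steps, RExp.steps, NExp.steps, NExp.eval, hn, hr, hU]
      intro a j
      by_cases ha : a = 1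
      swap
      · simp [ha]
        split_ifs <;> rfl
      subst ha
      rcases lt_trichotomy j i with hj | rfl | hj
    · simp [hj.ne, hj, hj.le]
    · simp [hb]
    · simp [hj.ne', hj.not_ge, show ¬ j < i by omega]
    · simp [hj.ne, hj, hj.le]
    · simp [hb]
    · simp [hj.ne', hj.not_ge, show ¬ j < i by omega]
  · rintro n m' h - - ⟨hn, hr⟩
    exact hQ n m' (by omega) hn hr

theorem wp_switchP {m : Mem} {U : ℕ} (hU : m.nat 0 1 = U) {Q : ℕ → Mem → Prop}
    (hQ : ∀ n m', n ≤ U * 50 + 20 →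
      (∀ a j, m'.nat a j = if a = 9 ∧ j = 0 then U else if a = 2 ∧ j < U then
        (if m.real 3 j ≤ m.real 2 (m.nat 11 0 + j) then m.nat 10 0 else m.nat 2 j)
        else m.nat a j) →
      (∀ a j, m'.real a j = if a = 3 ∧ j < U then
        (if m.real 3 j ≤ m.real 2 (m.nat 11 0 + j) then m.real 2 (m.nat 11 0 + j) else m.real 3 j)
        else m.real a j) → Q n m') :
    WP switchP m Q := by
  refine wp_forLoop (τ := 36) (N := U) (fun i m' =>
    (∀ a j, m'.nat a j = if a = 9 ∧ j = 0 then i else if a = 2 ∧ j < i then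
        (if m.real 3 j ≤ m.real 2 (m.nat 11 0 + j) then m.nat 10 0 else m.nat 2 j)
        else m.nat a j) ∧
    (∀ a j, m'.real a j = if a = 3 ∧ j < i then
        (if m.real 3 j ≤ m.real 2 (m.nat 11 0 + j) then m.real 2 (m.nat 11 0 + j) else m.real 3 j)
        else m.real a j))
    (by norm_num) hU ?_ ?_ ?_
  · exact ⟨fun a j => by simp, fun a j => by simp⟩
  · rintro i hi m' hv hp ⟨hn, hr⟩
    refine wp_cond (fun hb => wp_seq (wp_setReal (wp_setNat ?_))) (fun hb => wp_skip ?_)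
    all_goals
      simp [Test.holds, RExp.eval, NExp.eval, hn, hr] at hb
      simp [Test.steps, RExp.steps, NExp.steps, NExp.eval, RExp.eval, hn, hr, hU]
      constructor
      all_goals
        intro a j
        rcases lt_trichotomy j i with hj | rfl | hj
        · simp [hj.ne, hj, hj.le]
          try (split_ifs <;> rfl)
        · simp [hb]
          try (split_ifs <;> first | rfl | (intros; exfalso; linarith) | simp_all)
        · simp [hj.ne', hj.not_ge, show ¬ j < i by omega]
          try (split_ifs <;> rfl)
  · rintro n m' h - - ⟨hn, hr⟩
    exact hQ n m' (by omega) hn hr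

end RealRAM

/-! ### Correctness of the greedy program -/

namespace RealRAM

open GreedyMax (gain Feas Chosen Scan val)

/-- Two memories agree outside of the given arrays of naturals and of reals. -/
structure Frame (N R : List ℕ) (m m' : Mem) : Prop where
  nat : ∀ a ∉ N, m'.nat a = m.nat a
  real : ∀ a ∉ R, m'.real a = m.real a

theorem Frame.refl (N R : List ℕ) (m : Mem) : Frame N R m m := ⟨fun _ _ => rfl, fun _ _ => rfl⟩

theorem Frame.trans {N R N' R' N'' R'' : List ℕ} {m m' m'' : Mem} (h : Frame N R m m')
    (h' : Frame N' R' m' m'') (hN : N ⊆ N'') (hN' : N' ⊆ N'') (hR : R ⊆ R'') (hR' : R' ⊆ R'') :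
    Frame N'' R'' m m'' :=
  ⟨fun a ha => (h'.nat a fun h => ha (hN' h)).trans (h.nat a fun h => ha (hN h)),
    fun a ha => (h'.real a fun h => ha (hR' h)).trans (h.real a fun h => ha (hR h))⟩

theorem Frame.setNat {N R : List ℕ} {m m' : Mem} (h : Frame N R m m') {a : ℕ} (ha : a ∈ N)
    (i v : ℕ) : Frame N R m (m'.setNat a i v) :=
  ⟨fun b hb => by
    rw [← h.nat b hb]
    funext j
    simp [show b ≠ a from fun h => hb (h ▸ ha)], h.real⟩

theorem Frame.setReal {N R : List ℕ} {m m' : Mem} (h : Frame N R m m') {a : ℕ} (ha : a ∈ R)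
    (i : ℕ) (v : ℝ) : Frame N R m (m'.setReal a i v) :=
  ⟨h.nat, fun b hb => by
    rw [← h.real b hb]
    funext j
    simp [show b ≠ a from fun h => hb (h ▸ ha)]⟩

/-- The weights that are stored in an array whose row `k` begins at the cell `k * U`. -/
def weights (U : ℕ) (W : ℕ → ℝ) (u k : ℕ) : ℝ := W (k * U + u)

theorem wp_updateBestP {m : Mem} {U : ℕ} (hU : m.nat 0 1 = U) {Q : ℕ → Mem → Prop}
    (hQ : ∀ n m', n ≤ U * 40 + 50 → Frame [1, 9] [8] m m' →
      (m.real 8 0 < m.real 5 0 + m.real 6 0 → m'.real 8 0 = m.real 5 0 + m.real 6 0 ∧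
        ∀ u < U, m'.nat 1 u =
          if m.real 3 u ≤ m.real 2 (m.nat 8 0 + u) then m.nat 7 0 else m.nat 2 u) →
      (¬ m.real 8 0 < m.real 5 0 + m.real 6 0 → m'.real 8 0 = m.real 8 0 ∧
        ∀ u < U, m'.nat 1 u = m.nat 1 u) → Q n m') :
    WP updateBestP m Q := by
  refine wp_cond (fun hb => wp_seq (wp_setReal (wp_storeP (U := U) (by simpa using hU) ?_)))
    (fun hb => wp_skip ?_)
  all_goals simp [Test.holds, RExp.eval, NExp.eval] at hb
  · intro n m' hn h₁ h₂
    refine hQ _ m' ?_ ⟨fun a ha => ?_, fun a ha => ?_⟩ ?_ ?_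
    · simp [Test.steps, RExp.steps, NExp.steps]; omega
    · funext j
      simp at ha
      simp [h₁, ha]
    · funext j
      simp at ha
      simp [h₂, ha]
    · intro _
      refine ⟨by simp [h₂, NExp.eval, RExp.eval], fun u hu => ?_⟩
      simp [h₁, hu]
    · exact fun h => absurd hb h
  · refine hQ _ m ?_ (.refl _ _ _) (fun h => absurd h (not_lt.2 hb)) fun _ => ⟨rfl, fun _ _ => rfl⟩
    simp [Test.steps, RExp.steps, NExp.steps]

theorem wp_updateDensP {m : Mem} {Q : ℕ → Mem → Prop}
    (hQ : ∀ n m', n ≤ 100 → Frame [10, 11] [7, 9] m m' →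
      (m.real 7 0 < m.real 6 0 / m.real 0 (m.nat 7 0) →
        m'.real 7 0 = m.real 6 0 / m.real 0 (m.nat 7 0) ∧ m'.real 9 0 = m.real 6 0 ∧
        m'.nat 10 0 = m.nat 7 0 ∧ m'.nat 11 0 = m.nat 8 0) →
      (¬ m.real 7 0 < m.real 6 0 / m.real 0 (m.nat 7 0) →
        m'.real 7 0 = m.real 7 0 ∧ m'.real 9 0 = m.real 9 0 ∧
        m'.nat 10 0 = m.nat 10 0 ∧ m'.nat 11 0 = m.nat 11 0) → Q n m') :
    WP updateDensP m Q := by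
  refine wp_cond (fun hb => wp_seq (wp_setReal (wp_seq (wp_setReal
    (wp_seq (wp_setNat (wp_setNat ?_))))))) (fun hb => wp_skip ?_)
  all_goals simp [Test.holds, RExp.eval, NExp.eval] at hb
  · refine hQ _ _ ?_ ?_ ?_ ?_
    · simp [Test.steps, RExp.steps, NExp.steps]
    · exact ((((Frame.refl _ _ _).setReal (by simp) _ _).setReal (by simp) _ _).setNat
        (by simp) _ _).setNat (by simp) _ _
    · intro _
      simp [NExp.eval, RExp.eval]
    · exact fun h => absurd hb h
  · refine hQ _ m ?_ (.refl _ _ _) (fun h => absurd h (not_lt.2 hb))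
      fun _ => ⟨rfl, rfl, rfl, rfl⟩
    simp [Test.steps, RExp.steps, NExp.steps]

/-- The invariant of the scan that starts in the memory `m₀`. -/
structure ScanInv (m₀ : Mem) (i : ℕ) (m : Mem) : Prop where
  frame : Frame [1, 7, 8, 9, 10, 11] [6, 7, 8, 9] m₀ m
  base : m.nat 8 0 = i * m₀.nat 0 1
  choice_base : m.real 7 0 = 0 ∨ m.nat 11 0 = m.nat 10 0 * m₀.nat 0 1
  scan : Scan (m₀.nat 0 1) (m₀.nat 0 2) (weights (m₀.nat 0 1) (m₀.real 2)) (m₀.real 0) (m₀.nat 0 3)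
    (m₀.real 3) (m₀.real 4 0) (m₀.real 5 0) (m₀.real 8 0) i (m.nat 1) (m.nat 10 0) (m.real 8 0)
    (m.real 7 0) (m.real 9 0)

section Greedy

variable {m₀ m : Mem} {G : Finset ℕ} {j : ℕ}

/-- The part of the invariant of the greedy algorithm that a scan does not change. -/
abbrev ChosenMem (m : Mem) (G : Finset ℕ) : Prop :=
  Chosen (m.nat 0 1) (m.nat 0 2) (weights (m.nat 0 1) (m.real 2)) (m.real 0) (m.nat 0 3) G
    (m.real 3) (m.nat 2) (m.real 4 0) (m.real 5 0)

/-- The two branches realize `Scan.next` and `Scan.skip`. The many equations in the proof carry the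
cells that a later part reads through the frames of the earlier parts. -/
theorem wp_scanBodyP {i : ℕ} (hch : ChosenMem m₀ G) (hc : ∀ k < m₀.nat 0 2, 0 < m₀.real 0 k)
    (hw : ∀ u < m₀.nat 0 1, ∀ k < m₀.nat 0 2, 0 ≤ weights (m₀.nat 0 1) (m₀.real 2) u k)
    (hi : i < m₀.nat 0 2) (hv : m.nat 7 0 = i) (h : ScanInv m₀ i m) {Q : ℕ → Mem → Prop}
    (hQ : ∀ n m', n ≤ m₀.nat 0 1 * 100 + 240 → m'.nat 7 0 = i → m'.nat 0 = m₀.nat 0 →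
      ScanInv m₀ (i + 1) (m'.setNat 7 0 (i + 1)) → Q n m') :
    WP scanBodyP m Q := by
  have e0 : m.nat 0 = m₀.nat 0 := h.frame.nat 0 (by simp)
  have e2 : m.nat 2 = m₀.nat 2 := h.frame.nat 2 (by simp)
  have r0 : m.real 0 = m₀.real 0 := h.frame.real 0 (by simp)
  have r2 : m.real 2 = m₀.real 2 := h.frame.real 2 (by simp)
  have r3 : m.real 3 = m₀.real 3 := h.frame.real 3 (by simp)
  have r4 : m.real 4 = m₀.real 4 := h.frame.real 4 (by simp)
  have r5 : m.real 5 = m₀.real 5 := h.frame.real 5 (by simp)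
  refine wp_seq (wp_cond (fun hb => wp_seq (wp_gainP (U := m₀.nat 0 1) (by rw [e0]) ?_))
    (fun hb => wp_skip (wp_setNat ?_)))
  all_goals simp [Test.holds, RExp.eval, NExp.eval, e0, r0, r4, hv] at hb
  · intro n₁ m₁ hn₁ hN₁ hR₁
    refine wp_seq (wp_updateBestP (U := m₀.nat 0 1) (by simp [hN₁, e0]) ?_)
    intro n₂ m₂ hn₂ hf₂ hb₁ hb₂
    refine wp_updateDensP ?_
    intro n₃ m₃ hn₃ hf₃ hd₁ hd₂
    refine wp_setNat ?_
    have hf₁ : Frame [9] [6] m m₁ := by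
      refine ⟨fun a ha => ?_, fun a ha => ?_⟩ <;> funext l <;> simp at ha <;> simp [hN₁, hR₁, ha]
    have hg : m₁.real 6 0 = gain (m₀.nat 0 1) (weights (m₀.nat 0 1) (m₀.real 2)) (m₀.real 3) i := by
      simp [hR₁, gain, weights, h.base, r2, r3]
    have hf₄ : Frame [1, 7, 8, 9, 10, 11] [6, 7, 8, 9] m₀ m₃ :=
      ((h.frame.trans hf₁ (by simp) (by simp) (by simp) (by simp) :
        Frame [1, 7, 8, 9, 10, 11] [6, 7, 8, 9] m₀ m₁).trans hf₂ (by simp) (by simp) (by simp)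
          (by simp) : Frame [1, 7, 8, 9, 10, 11] [6, 7, 8, 9] m₀ m₂).trans hf₃
          (by simp) (by simp) (by simp) (by simp)
    have a5 : m₁.real 5 = m₀.real 5 := by rw [hf₁.real 5 (by simp), r5]
    have a8 : m₁.real 8 = m.real 8 := hf₁.real 8 (by simp)
    have a1 : m₁.nat 1 = m.nat 1 := hf₁.nat 1 (by simp)
    have a7 : m₁.nat 7 0 = i := by rw [hf₁.nat 7 (by simp), hv]
    have a2 : m₁.nat 2 = m₀.nat 2 := by rw [hf₁.nat 2 (by simp), e2]
    have s2 : m₁.real 2 = m₀.real 2 := by rw [hf₁.real 2 (by simp), r2]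
    have s3 : m₁.real 3 = m₀.real 3 := by rw [hf₁.real 3 (by simp), r3]
    have a8n : m₁.nat 8 0 = i * m₀.nat 0 1 := by rw [hf₁.nat 8 (by simp), h.base]
    have b6 : m₂.real 6 0 = gain (m₀.nat 0 1) (weights (m₀.nat 0 1) (m₀.real 2)) (m₀.real 3) i := by
      rw [hf₂.real 6 (by simp), hg]
    have b7 : m₂.real 7 = m.real 7 := by rw [hf₂.real 7 (by simp), hf₁.real 7 (by simp)]
    have b9 : m₂.real 9 = m.real 9 := by rw [hf₂.real 9 (by simp), hf₁.real 9 (by simp)]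
    have b0 : m₂.real 0 = m₀.real 0 := by
      rw [hf₂.real 0 (by simp), hf₁.real 0 (by simp), r0]
    have b7n : m₂.nat 7 0 = i := by rw [hf₂.nat 7 (by simp), a7]
    have b8n : m₂.nat 8 0 = i * m₀.nat 0 1 := by rw [hf₂.nat 8 (by simp), a8n]
    have b10 : m₂.nat 10 = m.nat 10 := by rw [hf₂.nat 10 (by simp), hf₁.nat 10 (by simp)]
    have b11 : m₂.nat 11 = m.nat 11 := by rw [hf₂.nat 11 (by simp), hf₁.nat 11 (by simp)]
    have c8 : m₃.real 8 = m₂.real 8 := hf₃.real 8 (by simp)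
    have c1 : m₃.nat 1 = m₂.nat 1 := hf₃.nat 1 (by simp)
    have c7 : m₃.nat 7 0 = i := by rw [hf₃.nat 7 (by simp), b7n]
    have c8n : m₃.nat 8 0 = i * m₀.nat 0 1 := by rw [hf₃.nat 8 (by simp), b8n]
    have c0 : m₃.nat 0 = m₀.nat 0 := hf₄.nat 0 (by simp)
    simp only [hg, a8, a5, a1, a2, s2, s3, a7, a8n] at hb₁ hb₂
    simp only [b6, b7, b9, b0, b7n, b8n, b10, b11] at hd₁ hd₂
    have hnext := h.scan.next hch hc hw hi hb (out' := m₃.nat 1) (bk' := m₃.nat 10 0)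
      (best' := m₃.real 8 0) (dens' := m₃.real 7 0) (bgain' := m₃.real 9 0)
      (by rw [c8, c1]; exact hb₁) (by rw [c8, c1]; exact hb₂)
      (fun hlt => ⟨(hd₁ hlt).1, (hd₁ hlt).2.1, (hd₁ hlt).2.2.1⟩)
      (fun hlt => ⟨(hd₂ hlt).1, (hd₂ hlt).2.1, (hd₂ hlt).2.2.1⟩)
    refine hQ _ _ ?_ ?_ ?_ ⟨(hf₄.setNat (by simp) _ _).setNat (by simp) _ _, ?_, ?_, ?_⟩
    · simp [Test.steps, RExp.steps, NExp.steps]; omega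
    · simp [c7]
    · funext l; simp [c0]
    · simp [NExp.eval, c8n, c0]; ring
    · simp
      by_cases hlt : m.real 7 0 <
          gain (m₀.nat 0 1) (weights (m₀.nat 0 1) (m₀.real 2)) (m₀.real 3) i / m₀.real 0 i
      · right; rw [(hd₁ hlt).2.2.1, (hd₁ hlt).2.2.2]
      · rw [(hd₂ hlt).1, (hd₂ hlt).2.2.1, (hd₂ hlt).2.2.2]; exact h.choice_base
    · have q1 : ∀ x y, ((m₃.setNat 8 x y).setNat 7 0 (i + 1)).nat 1 = m₃.nat 1 := by
        intro x y; funext l; simp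
      rw [show NExp.eval m₃ (NExp.lit 0) = 0 from rfl, q1]
      simpa using hnext
  · refine hQ _ _ ?_ ?_ ?_ ⟨(h.frame.setNat (by simp) _ _).setNat (by simp) _ _, ?_, ?_, ?_⟩
    · simp [Test.steps, RExp.steps, NExp.steps]
    · simp [hv]
    · funext l; simp [e0]
    · simp [NExp.eval, h.base, e0]; ring
    · simpa using h.choice_base
    · have q1 : ∀ x y, ((m.setNat 8 x y).setNat 7 0 (i + 1)).nat 1 = m.nat 1 := by
        intro x y; funext l; simp
      rw [show NExp.eval m (NExp.lit 0) = 0 from rfl, q1]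
      simpa using h.scan.skip (not_le.2 hb)

/-- The invariant of the greedy algorithm. -/
abbrev InvMem (j : ℕ) (G : Finset ℕ) (m : Mem) : Prop :=
  GreedyMax.Inv (m.nat 0 1) (m.nat 0 2) (weights (m.nat 0 1) (m.real 2)) (m.real 0) (m.nat 0 3) j G
    (m.real 3) (m.nat 2) (m.nat 1) (m.real 4 0) (m.real 5 0) (m.real 8 0)

theorem wp_scanP (h : InvMem j G m₀) (hc : ∀ k < m₀.nat 0 2, 0 < m₀.real 0 k)
    (hw : ∀ u < m₀.nat 0 1, ∀ k < m₀.nat 0 2, 0 ≤ weights (m₀.nat 0 1) (m₀.real 2) u k)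
    {Q : ℕ → Mem → Prop}
    (hQ : ∀ n m', n ≤ m₀.nat 0 2 * (m₀.nat 0 1 * 100 + 260) + 40 →
      ScanInv m₀ (m₀.nat 0 2) m' → Q n m') :
    WP scanP m₀ Q := by
  refine wp_seq (wp_setReal (wp_seq (wp_setNat ?_)))
  refine wp_forLoop (τ := m₀.nat 0 1 * 100 + 240) (N := m₀.nat 0 2) (ScanInv m₀) (by norm_num)
    (by simp) ?_ ?_ ?_
  · refine ⟨((((Frame.refl _ _ _).setReal (by simp) _ _).setNat (by simp) _ _).setNat
      (by simp) _ _), ?_, ?_, ?_⟩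
    · simp [NExp.eval]
    · left; simp [NExp.eval, RExp.eval]
    · have q1 : ∀ x y, (((m₀.setReal 7 (NExp.eval m₀ (.lit 0)) (RExp.eval m₀ rzero)).setNat
          8 x y).setNat 7 0 0).nat 1 = m₀.nat 1 := by
        intro x y; funext l; simp
      rw [q1]
      simpa [NExp.eval, RExp.eval] using h.scan_zero
  · intro i hi m' hv hp hI
    refine wp_scanBodyP h.chosen hc hw hi hv hI fun n m'' hn hv' h0 hI' => ⟨hn, hv', ?_, hI'⟩
    rw [h0]
  · intro n m' hn _ _ hI
    refine hQ _ _ ?_ hI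
    have := Nat.mul_le_mul_left (m₀.nat 0 2)
      (show m₀.nat 0 1 * 100 + 240 + 14 ≤ m₀.nat 0 1 * 100 + 260 by omega)
    simp [RExp.steps, NExp.steps]
    omega

theorem wp_addP (h : InvMem j G m₀) (hc : ∀ k < m₀.nat 0 2, 0 < m₀.real 0 k)
    (hw : ∀ u < m₀.nat 0 1, ∀ k < m₀.nat 0 2, 0 ≤ weights (m₀.nat 0 1) (m₀.real 2) u k)
    (hs : ScanInv m₀ (m₀.nat 0 2) m) {Q : ℕ → Mem → Prop}
    (hQ : ∀ n m', n ≤ m₀.nat 0 1 * 50 + 70 →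
      Frame [1, 2, 7, 8, 9, 10, 11] [3, 4, 5, 6, 7, 8, 9] m₀ m' →
      (∃ G', InvMem (j + 1) G' m') → Q n m') :
    WP addP m Q := by
  have e0 : m.nat 0 = m₀.nat 0 := hs.frame.nat 0 (by simp)
  have e2 : m.nat 2 = m₀.nat 2 := hs.frame.nat 2 (by simp)
  have r0 : m.real 0 = m₀.real 0 := hs.frame.real 0 (by simp)
  have r2 : m.real 2 = m₀.real 2 := hs.frame.real 2 (by simp)
  have r3 : m.real 3 = m₀.real 3 := hs.frame.real 3 (by simp)
  have r4 : m.real 4 = m₀.real 4 := hs.frame.real 4 (by simp)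
  have r5 : m.real 5 = m₀.real 5 := hs.frame.real 5 (by simp)
  refine wp_cond (fun hb => wp_seq (wp_setReal (wp_seq (wp_setReal
    (wp_switchP (U := m₀.nat 0 1) (by simp [e0]) ?_))))) (fun hb => wp_skip ?_)
  all_goals simp [Test.holds, RExp.eval, NExp.eval] at hb
  · intro n m' hn hN hR
    -- A positive density shows that some arm has been selected in this scan, so its stored row
    -- offset is valid.
    have hbase : m.nat 11 0 = m.nat 10 0 * m₀.nat 0 1 := hs.choice_base.resolve_left hb.ne'
    have f0 : m'.nat 0 = m₀.nat 0 := by funext l; simp [hN, e0]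
    have f1 : m'.nat 1 = m.nat 1 := by funext l; simp [hN]
    have t0 : m'.real 0 = m₀.real 0 := by funext l; simp [hR, r0]
    have t2 : m'.real 2 = m₀.real 2 := by funext l; simp [hR, r2]
    refine hQ _ m' ?_ ⟨fun a ha => ?_, fun a ha => ?_⟩ ⟨insert (m.nat 10 0) G, ?_⟩
    · simp [Test.steps, RExp.steps, NExp.steps]; omega
    · funext l
      simp at ha
      simp [hN, ha, hs.frame.nat a (by simp [ha])]
    · funext l
      simp at ha
      simp [hR, ha, hs.frame.real a (by simp [ha])]
    · have := h.step hs.scan hc hw hb (cur' := m'.real 3) (arm' := m'.nat 2)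
        (fun u hu => by simp [hR, hu, hbase, r2, r3, weights]; congr)
        (fun u hu => by simp [hN, hu, hbase, e2, r2, r3, weights]; congr)
      have g4 : m'.real 4 0 = m₀.real 4 0 + m₀.real 0 (m.nat 10 0) := by
        simp [hR, NExp.eval, RExp.eval, r4, r0]
      have g5 : m'.real 5 0 = m₀.real 5 0 + m.real 9 0 := by
        simp [hR, NExp.eval, RExp.eval, r5]
      have g8 : m'.real 8 0 = m.real 8 0 := by simp [hR]
      rwa [InvMem, f0, f1, t0, t2, g4, g5, g8]
  · refine hQ _ m ?_ (hs.frame.trans (.refl [] [] m) (by simp) (by simp) (by simp) (by simp))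
      ⟨G, ?_⟩
    · simp [Test.steps, RExp.steps, NExp.steps]
    · have := h.stay hs.scan hw (not_lt.2 hb)
      rwa [InvMem, e0, e2, r0, r2, r3, r4, r5]

/-- The greedy algorithm finds a feasible matching that has at least half of the value of every
feasible matching. -/
theorem wp_greedyP {U K B : ℕ} (hU : m.nat 0 1 = U) (hK : m.nat 0 2 = K) (hB : m.nat 0 3 = B)
    (hU0 : 0 < U) (hK0 : 0 < K)
    (hc : ∀ k < K, 0 < m.real 0 k) (hcB : ∀ k < K, m.real 0 k ≤ B)
    (hw : ∀ u < U, ∀ k < K, 0 ≤ weights U (m.real 2) u k) {Q : ℕ → Mem → Prop}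
    (hQ : ∀ n m', n ≤ K * (K * (U * 100 + 260) + U * 50 + 130) + U * 30 + 60 →
      Frame [1, 2, 6, 7, 8, 9, 10, 11] [3, 4, 5, 6, 7, 8, 9] m m' →
      Feas U K (m.real 0) B (m'.nat 1) →
      (∀ π, Feas U K (m.real 0) B π → val U (weights U (m.real 2)) π ≤
        2 * val U (weights U (m.real 2)) (m'.nat 1)) → Q n m') :
    WP greedyP m Q := by
  subst hU hK hB
  refine wp_seq (wp_initP rfl fun n₁ m₁ hn₁ hN₁ hR₁ => ?_)
  have e0 : m₁.nat 0 = m.nat 0 := by funext l; simp [hN₁]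
  have r0 : m₁.real 0 = m.real 0 := by funext l; simp [hR₁]
  have r2 : m₁.real 2 = m.real 2 := by funext l; simp [hR₁]
  -- The constant `111` is `40` from the scan, `70` from the addition and `1` for their sequencing.
  refine wp_forLoop (τ := m.nat 0 2 * (m.nat 0 1 * 100 + 260) + m.nat 0 1 * 50 + 111)
    (N := m.nat 0 2) (fun i m' => (∃ G, InvMem i G m') ∧
      Frame [1, 2, 6, 7, 8, 9, 10, 11] [3, 4, 5, 6, 7, 8, 9] m m') (by norm_num)
    (by rw [e0]) ?_ ?_ ?_
  · have f0 : (m₁.setNat 6 0 0).nat 0 = m.nat 0 := by funext l; simp [e0]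
    refine ⟨⟨∅, ?_⟩, ?_⟩
    · have := GreedyMax.inv_zero (B := m.nat 0 3) (cur := m₁.real 3) (arm := (m₁.setNat 6 0 0).nat 2)
        (out := (m₁.setNat 6 0 0).nat 1) hK0 hc hcB hw (fun u hu => by simp [hR₁, hu])
        (fun u hu => by simp [hN₁, hu])
      simp only [InvMem, f0, Mem.setNat_real, r0, r2]
      simpa [hR₁] using this
    · refine Frame.setNat ⟨fun a ha => ?_, fun a ha => ?_⟩ (by simp) _ _ <;> funext l <;>
        simp at ha <;> simp [hN₁, hR₁, ha]
  · rintro i hi m' hv hp ⟨⟨G, hG⟩, hf⟩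
    have a0 : m'.nat 0 = m.nat 0 := hf.nat 0 (by simp)
    have s0 : m'.real 0 = m.real 0 := hf.real 0 (by simp)
    have s2 : m'.real 2 = m.real 2 := hf.real 2 (by simp)
    have hc' : ∀ k < m'.nat 0 2, 0 < m'.real 0 k := by rwa [a0, s0]
    have hw' : ∀ u < m'.nat 0 1, ∀ k < m'.nat 0 2, 0 ≤ weights (m'.nat 0 1) (m'.real 2) u k := by
      rwa [a0, s2]
    refine wp_seq (wp_scanP hG hc' hw' fun n₂ m₂ hn₂ hs => ?_)
    refine wp_addP hG hc' hw' hs fun n₃ m₃ hn₃ hf₃ ⟨G', hG'⟩ => ?_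
    have hf' : Frame [1, 2, 6, 7, 8, 9, 10, 11] [3, 4, 5, 6, 7, 8, 9] m m₃ :=
      hf.trans hf₃ (by simp) (by simp) (by simp) (by simp)
    rw [a0] at hn₂ hn₃
    refine ⟨by omega, ?_, ?_, ⟨G', ?_⟩, hf'.setNat (by simp) _ _⟩
    · rw [hf₃.nat 6 (by simp), hv]
    · rw [hf'.nat 0 (by simp)]
    · have q : ∀ a, a ≠ 6 → (m₃.setNat 6 0 (i + 1)).nat a = m₃.nat a := by
        intro a ha; funext l; simp [ha]
      simpa only [InvMem, q 0 (by simp), q 1 (by simp), q 2 (by simp), Mem.setNat_real] using hG'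
  · rintro n m' hn - - ⟨⟨G, hG⟩, hf⟩
    have a0 : m'.nat 0 = m.nat 0 := hf.nat 0 (by simp)
    have s0 : m'.real 0 = m.real 0 := hf.real 0 (by simp)
    have s2 : m'.real 2 = m.real 2 := hf.real 2 (by simp)
    rw [InvMem, a0, s0, s2] at hG
    refine hQ _ m' ?_ hf hG.feas fun π hπ => hG.half_le hU0 hw hπ
    ring_nf at hn ⊢
    omega

end Greedy

end RealRAM

namespace RealRAM

open CBR
open GreedyMax (Feas val)

/-! ### The invariant of the program -/

/-- The number of exploration rounds of each arm: the least `n` with `T ^ 2 ≤ n ^ 3`. -/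
def exploreLen (T : ℕ) : ℕ :=
  Nat.find (p := fun n => T ^ 2 ≤ n ^ 3) ⟨T, by
    rcases Nat.eq_zero_or_pos T with rfl | h
    · norm_num
    · exact Nat.pow_le_pow_right h (by norm_num)⟩

/-- By monotonicity of the cube, comparing `n ^ 3` with `T ^ 2` decides whether exploration goes on,
so the machine needs neither roots nor a stored `exploreLen T`. -/
theorem lt_exploreLen_iff {T n : ℕ} : n < exploreLen T ↔ n ^ 3 < T ^ 2 := by
  rw [exploreLen, Nat.lt_find_iff]
  constructor
  · intro h
    exact not_le.1 (h n le_rfl)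
  · intro h k hk
    exact not_le.2 ((Nat.pow_le_pow_left hk 3).trans_lt h)

/-- The sum of the positive parts of the rewards of user `u` from arm `k` that were observed during
the exploration. -/
noncomputable def exploredSum {P : Params} : List (Obs P) → Fin P.U → ℕ → ℝ
  | [], _, _ => 0
  | x :: h, u, k => exploredSum h u k +
      if h.length < exploreLen P.T * P.K ∧ h.length % P.K = k then max 0 (x u) else 0

/-- The program has to behave well on arbitrary real observations, while the greedy analysis needs
nonnegative weights. Taking positive parts ensures this and changes nothing almost surely. -/
theorem exploredSum_nonneg {P : Params} (h : List (Obs P)) (u : Fin P.U) (k : ℕ) :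
    0 ≤ exploredSum h u k := by
  induction h with
  | nil => exact le_rfl
  | cons x h ih =>
    rw [exploredSum]
    split_ifs
    · exact add_nonneg ih (le_max_left _ _)
    · simpa using ih

/-- The invariant: the observations `h` have been recorded. -/
structure Recorded (P : Params) (h : List (Obs P)) (m : Mem) : Prop where
  params : m.nat 0 = (initMem P).nat 0
  cost : m.real 0 = (initMem P).real 0
  started : m.nat 12 0 = 1
  arm_lt : m.nat 3 0 < P.K
  base : m.nat 4 0 = m.nat 3 0 * P.U
  count : m.nat 5 0 * P.K + m.nat 3 0 = min h.length (exploreLen P.T * P.K)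
  sums : ∀ (u : Fin P.U), ∀ k < P.K, m.real 2 (k * P.U + u) = exploredSum h u k

variable {P : Params} {h : List (Obs P)} {m : Mem}

theorem Recorded.transfer (hm : Recorded P h m) {m' : Mem} (e0 : m'.nat 0 = m.nat 0)
    (e3 : m'.nat 3 = m.nat 3) (e4 : m'.nat 4 = m.nat 4) (e5 : m'.nat 5 = m.nat 5)
    (e12 : m'.nat 12 = m.nat 12) (r0 : m'.real 0 = m.real 0) (r2 : m'.real 2 = m.real 2) :
    Recorded P h m' where
  params := e0 ▸ hm.params
  cost := r0 ▸ hm.cost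
  started := e12 ▸ hm.started
  arm_lt := e3 ▸ hm.arm_lt
  base := by rw [e4, e3, hm.base]
  count := by rw [e5, e3, hm.count]
  sums := r2 ▸ hm.sums

/-- The counters are quotient and remainder by `K` of the number of recorded rounds, capped at
`exploreLen T * K`. -/
theorem Recorded.lt_iff (hm : Recorded P h m) :
    m.nat 5 0 < exploreLen P.T ↔ h.length < exploreLen P.T * P.K := by
  have h₁ := hm.count
  have h₂ := hm.arm_lt
  constructor
  · intro hlt
    have := Nat.mul_le_mul_right P.K (Nat.succ_le_of_lt hlt)
    rw [Nat.succ_mul] at this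
    omega
  · intro hlt
    by_contra! hle
    have := Nat.mul_le_mul_right P.K hle
    omega

theorem Recorded.arm_eq (hm : Recorded P h m) (hlt : h.length < exploreLen P.T * P.K) :
    m.nat 3 0 = h.length % P.K := by
  have h₁ := hm.count
  rw [min_eq_left hlt.le] at h₁
  rw [← h₁, Nat.mul_comm, Nat.mul_add_mod, Nat.mod_eq_of_lt hm.arm_lt]

theorem exploring_holds_iff (h0 : m.nat 0 0 = P.T) :
    exploring.holds m ↔ m.nat 5 0 < exploreLen P.T := by
  rw [lt_exploreLen_iff]
  simp only [exploring, Test.holds, RExp.eval, NExp.eval, h0, not_le]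
  rw [show ((m.nat 5 0 : ℝ) * m.nat 5 0 * m.nat 5 0) = ((m.nat 5 0 ^ 3 : ℕ) : ℝ) by
    push_cast; ring, show ((P.T : ℝ) * P.T) = ((P.T ^ 2 : ℕ) : ℝ) by push_cast; ring]
  exact Nat.cast_lt

/-- Uniqueness of division with remainder; it shows that recording into one row of the weight array
leaves the other rows unchanged. -/
theorem row_iff {U u k l : ℕ} (hu : u < U) :
    (l * U ≤ k * U + u ∧ k * U + u < l * U + U) ↔ k = l := by
  constructor
  · rintro ⟨h₁, h₂⟩
    rcases lt_trichotomy k l with h | h | h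
    · have := Nat.mul_le_mul_right U (Nat.succ_le_of_lt h)
      rw [Nat.succ_mul] at this
      omega
    · exact h
    · have := Nat.mul_le_mul_right U (Nat.succ_le_of_lt h)
      rw [Nat.succ_mul] at this
      omega
  · rintro rfl
    omega

/-- Record the last observation and move on to the next arm. -/
theorem wp_record_advance (hm : Recorded P h m) (x : Obs P)
    (hlt : h.length < exploreLen P.T * P.K) {Q : ℕ → Mem → Prop}
    (hQ : ∀ n m', n ≤ P.U * 40 + 70 → Recorded P (x :: h) m' → Q n m') :
    WP (.seq recordP advanceP) (observe m x) Q := by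
  have p1 : m.nat 0 1 = P.U := by rw [hm.params]; simp [initMem]
  have p2 : m.nat 0 2 = P.K := by rw [hm.params]; simp [initMem]
  refine wp_seq (wp_recordP (m := observe m x) (U := P.U) p1 fun n₁ m₁ hn₁ hN₁ hR₁ => ?_)
  have hobs : ∀ u : Fin P.U, (observe m x).real 1 u = x u := fun u => by simp [observe]
  have hr : ∀ a, a ≠ 1 → (observe m x).real a = m.real a := fun a ha => by simp [observe, ha]
  have hN : ∀ a j, m₁.nat a j = if a = 9 ∧ j = 0 then P.U else m.nat a j := hN₁
  have hsums : ∀ (u : Fin P.U), ∀ k < P.K,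
      m₁.real 2 (k * P.U + u) = exploredSum (x :: h) u k := by
    intro u k hk
    have hb : (observe m x).nat 4 0 = m.nat 3 0 * P.U := hm.base
    rw [hR₁, exploredSum, hb, ← hm.arm_eq hlt]
    simp only [true_and, row_iff u.2, hlt, hr 2 (by norm_num), hm.sums u k hk]
    by_cases hk' : k = m.nat 3 0
    · subst hk'
      simp [hobs]
    · rw [if_neg hk', if_neg (Ne.symm hk'), add_zero]
  have hcost : m₁.real 0 = (initMem P).real 0 := by
    rw [← hm.cost]; funext l; simp [hR₁, hr]
  have hpar : m₁.nat 0 = (initMem P).nat 0 := by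
    rw [← hm.params]; funext l; simp [hN]
  have hcount := hm.count
  rw [min_eq_left hlt.le] at hcount
  have hmin : min (x :: h).length (exploreLen P.T * P.K) = m.nat 5 0 * P.K + m.nat 3 0 + 1 := by
    rw [List.length_cons, hcount]; omega
  have harm := hm.arm_lt
  refine wp_seq (wp_setNat (wp_seq (wp_setNat
    (wp_cond (fun hb => wp_seq (wp_setNat (wp_seq (wp_setNat (wp_setNat ?_)))))
      (fun hb => wp_skip ?_)))))
  all_goals simp [Test.holds, NExp.eval, hN, p2] at hb
  · refine hQ _ _ ?_ ⟨?_, ?_, ?_, ?_, ?_, ?_, ?_⟩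
    · simp [Test.steps, NExp.steps]; omega
    · rw [← hpar]; funext l; simp
    · simpa using hcost
    · simp [NExp.eval, hN, hm.started]
    · simpa [NExp.eval] using P.K_pos
    · simp [NExp.eval]
    · rw [hmin]
      -- The sweep is complete: the arm counter wraps to `0` and the quotient absorbs the carry.
      have : P.K = m.nat 3 0 + 1 := by omega
      simp [NExp.eval, hN]
      rw [Nat.succ_mul]
      omega
    · simpa using hsums
  · refine hQ _ _ ?_ ⟨?_, ?_, ?_, ?_, ?_, ?_, ?_⟩
    · simp [Test.steps, NExp.steps]; omega
    · rw [← hpar]; funext l; simp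
    · simpa using hcost
    · simp [NExp.eval, hN, hm.started]
    · simpa [NExp.eval, hN] using hb
    · simp [NExp.eval, hN, hm.base, p1]; ring
    · rw [hmin]
      simp [NExp.eval, hN]
      omega
    · simpa using hsums

/-- What the output of a round after the observations `h` has to satisfy. -/
structure GoodOutput (P : Params) (h : List (Obs P)) (out : ℕ → ℕ) : Prop where
  lt : ∀ u < P.U, out u < P.K
  explore : h.length < exploreLen P.T * P.K → ∀ u < P.U, out u = h.length % P.K
  feas : exploreLen P.T * P.K ≤ h.length → Feas P.U P.K ((initMem P).real 0) P.B out
  half : exploreLen P.T * P.K ≤ h.length → ∀ π, Feas P.U P.K ((initMem P).real 0) P.B π →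
    ∑ u : Fin P.U, exploredSum h u (π u) ≤ 2 * ∑ u : Fin P.U, exploredSum h u (out u)

theorem Recorded.val_eq (hm : Recorded P h m) {π : ℕ → ℕ} (hπ : ∀ u < P.U, π u < P.K) :
    val P.U (weights P.U (m.real 2)) π = ∑ u : Fin P.U, exploredSum h u (π u) := by
  rw [val, Finset.sum_range]
  exact Finset.sum_congr rfl fun u _ => hm.sums u _ (hπ u u.2)

/-- In every commitment round the greedy algorithm is run anew on the unchanged weights, at a cost
of order `K ^ 2 * U`; the arrays it overwrites are disjoint from those that `Recorded` describes. -/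
theorem wp_output (hm : Recorded P h m) {Q : ℕ → Mem → Prop}
    (hQ : ∀ n m', n ≤ P.K * (P.K * (P.U * 100 + 260) + P.U * 50 + 130) + P.U * 30 + 100 →
      Recorded P h m' → GoodOutput P h (m'.nat 1) → Q n m') :
    WP (.cond exploring fillP greedyP) m Q := by
  have p0 : m.nat 0 0 = P.T := by rw [hm.params]; simp [initMem]
  have p1 : m.nat 0 1 = P.U := by rw [hm.params]; simp [initMem]
  have p2 : m.nat 0 2 = P.K := by rw [hm.params]; simp [initMem]
  have p3 : m.nat 0 3 = P.B := by rw [hm.params]; simp [initMem]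
  have hK := P.K_pos
  refine wp_cond (fun hb => ?_) fun hb => ?_
  all_goals rw [exploring_holds_iff p0, hm.lt_iff] at hb
  · refine wp_fillP p1 fun n m' hn hN hR => hQ _ _ ?_ ?_ ?_
    · simp [exploring, Test.steps, RExp.steps, NExp.steps]; omega
    · refine hm.transfer ?_ ?_ ?_ ?_ ?_ ?_ ?_ <;> funext l <;> simp [hN, hR]
    · have hout : ∀ u < P.U, m'.nat 1 u = h.length % P.K := fun u hu => by
        rw [hN, ← hm.arm_eq hb]; simp [hu]
      refine ⟨fun u hu => hout u hu ▸ Nat.mod_lt _ hK, fun _ => hout, fun hle => ?_, fun hle => ?_⟩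
      all_goals omega
  · have hcost : ∀ k (hk : k < P.K), m.real 0 k = P.cost ⟨k, hk⟩ := fun k hk => by
      rw [hm.cost]; simp [initMem, hk]
    have hw : ∀ u < P.U, ∀ k < P.K, 0 ≤ weights P.U (m.real 2) u k := fun u hu k hk => by
      rw [weights, hm.sums ⟨u, hu⟩ k hk]
      exact exploredSum_nonneg _ _ _
    refine wp_greedyP p1 p2 p3 P.U_pos hK (fun k hk => hcost k hk ▸ P.cost_pos _)
      (fun k hk => hcost k hk ▸ P.cost_le _) hw fun n m' hn hf hfeas hhalf => ?_
    refine hQ _ _ ?_ ?_ ?_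
    · simp [exploring, Test.steps, RExp.steps, NExp.steps]; omega
    · exact hm.transfer (hf.nat _ (by simp)) (hf.nat _ (by simp)) (hf.nat _ (by simp))
        (hf.nat _ (by simp)) (hf.nat _ (by simp)) (hf.real _ (by simp)) (hf.real _ (by simp))
    · refine ⟨hfeas.lt, fun hlt => absurd hlt hb, fun _ => hm.cost ▸ hfeas, fun _ π hπ => ?_⟩
      rw [← hm.val_eq hπ.lt, ← hm.val_eq hfeas.lt]
      exact hhalf π (hm.cost ▸ hπ)

/-- The number of steps of a round. -/
abbrev stepBound (P : Params) : ℕ := 1000 * P.K ^ 3 * P.U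

/-- As `K` and `U` are at least `1`, every monomial on the left is at most `K ^ 3 * U`, and the
coefficients sum to `820`. The last summand covers recording, advancing and the tests. -/
theorem le_stepBound (P : Params) :
    P.K * (P.K * (P.U * 100 + 260) + P.U * 50 + 130) + P.U * 30 + 100 + (P.U * 40 + 110) ≤
      stepBound P := by
  obtain ⟨K, hK⟩ : ∃ K, P.K = K + 1 := ⟨P.K - 1, by have := P.K_pos; omega⟩
  obtain ⟨U, hU⟩ : ∃ U, P.U = U + 1 := ⟨P.U - 1, by have := P.U_pos; omega⟩
  rw [stepBound, hK, hU]
  ring_nf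
  nlinarith [Nat.zero_le (K * U), Nat.zero_le (K ^ 2 * U), Nat.zero_le (K ^ 3 * U),
    Nat.zero_le (K ^ 2), Nat.zero_le (K ^ 3)]

/-- The observation of a round is written after the program has stopped, so it is recorded only at
the start of the next round. At the end of a round the invariant therefore concerns the observations
of the preceding rounds, and the flag in array `12` prevents recording in the first round. -/
theorem banditP_spec {h : List (Obs P)} {m : Mem} (hm : AtRound banditP P h m) :
    ∃ n m', Exec banditP m n m' ∧ n ≤ stepBound P ∧ Recorded P h m' ∧
      GoodOutput P h (m'.nat 1) := by
  have hsteps := le_stepBound P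
  induction hm with
  | start =>
    have hrec : Recorded P [] ((initMem P).setNat 12 0 1) := by
      refine ⟨?_, rfl, by simp, ?_, ?_, ?_, ?_⟩
      · funext l; simp
      · simpa [initMem] using P.K_pos
      · simp [initMem]
      · simp [initMem]
      · intro u k hk
        simp [initMem, exploredSum]
    show WP banditP (initMem P) _
    refine wp_seq (wp_cond (fun hb => ?_) fun hb => wp_setNat (wp_output hrec ?_))
    · simp [Test.holds, NExp.eval, initMem] at hb
    · intro n m' hn hm' hg
      refine ⟨?_, hm', hg⟩
      simp [exploring, Test.steps, RExp.steps, NExp.steps]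
      omega
  | @next h m m' n x hm he ih =>
    obtain ⟨n₁, m₁, he₁, -, hrec, -⟩ := ih
    obtain ⟨rfl, rfl⟩ := he.unique he₁
    have p0 : (observe m' x).nat 0 0 = P.T := by
      rw [show (observe m' x).nat 0 = m'.nat 0 from rfl, hrec.params]; simp [initMem]
    have hst : (observe m' x).nat 12 0 = 1 := hrec.started
    -- The counters still describe `h`, so this first test asks whether the round that produced `x`
    -- was an exploration round. The second test, after the update, concerns the new round.
    have hiff : exploring.holds (observe m' x) ↔ h.length < exploreLen P.T * P.K := by
      rw [exploring_holds_iff p0]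
      exact hrec.lt_iff
    show WP banditP (observe m' x) _
    refine wp_seq (wp_cond (fun hb => ?_) fun hb => wp_setNat ?_)
    all_goals
      simp only [Test.holds, NExp.eval, hst, le_refl, true_and, hiff] at hb
    · refine wp_record_advance hrec x hb fun n₁ m₁ hn₁ hrec₁ => ?_
      refine wp_output hrec₁ fun n₂ m₂ hn₂ hrec₂ hg => ⟨?_, hrec₂, hg⟩
      simp [exploring, Test.steps, RExp.steps, NExp.steps]
      omega
    · refine wp_output (h := x :: h) ?_ fun n₂ m₂ hn₂ hrec₂ hg => ⟨?_, hrec₂, hg⟩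
      · refine ⟨?_, ?_, by simp [NExp.eval], ?_, ?_, ?_, ?_⟩
        · rw [← hrec.params]; funext l; simp [observe]
        · rw [← hrec.cost]; simp [observe]
        · simpa [observe] using hrec.arm_lt
        · simpa [observe] using hrec.base
        · rw [List.length_cons, min_eq_right (by omega)]
          have := hrec.count
          rw [min_eq_right (by omega)] at this
          simpa [observe] using this
        · intro u k hk
          rw [exploredSum, if_neg (fun h => hb h.1), add_zero, ← hrec.sums u k hk]
          simp [observe]
      · simp [exploring, Test.steps, RExp.steps, NExp.steps]
        omega

end RealRAM

namespace CBR

open ProbabilityTheory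

variable {P : Params}

/-! ### The table of rewards -/

instance (E : Env P) : IsProbabilityMeasure E.law := by
  have : ∀ i : ℕ × Fin P.U × Fin P.K, IsProbabilityMeasure (E.D i.2.1 i.2.2) :=
    fun i => E.prob i.2.1 i.2.2
  unfold Env.law
  infer_instance

theorem Env.measurePreserving_eval (E : Env P) (i : ℕ × Fin P.U × Fin P.K) :
    MeasurePreserving (fun r : Table P => r i) E.law (E.D i.2.1 i.2.2) := by
  have : ∀ i : ℕ × Fin P.U × Fin P.K, IsProbabilityMeasure (E.D i.2.1 i.2.2) :=
    fun i => E.prob i.2.1 i.2.2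
  exact measurePreserving_eval_infinitePi (fun i : ℕ × Fin P.U × Fin P.K => E.D i.2.1 i.2.2) i

theorem Env.iIndepFun_eval (E : Env P) :
    iIndepFun (fun (i : ℕ × Fin P.U × Fin P.K) (r : Table P) => r i) E.law := by
  have : ∀ i : ℕ × Fin P.U × Fin P.K, IsProbabilityMeasure (E.D i.2.1 i.2.2) :=
    fun i => E.prob i.2.1 i.2.2
  exact iIndepFun_infinitePi (P := fun i : ℕ × Fin P.U × Fin P.K => E.D i.2.1 i.2.2)
    (X := fun _ x => x) fun _ => measurable_id

theorem Env.ae_mem_Icc (E : Env P) : ∀ᵐ r ∂E.law, ∀ i, r i ∈ Set.Icc (0 : ℝ) 1 :=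
  ae_all_iff.2 fun i =>
    (E.measurePreserving_eval i).quasiMeasurePreserving.ae (E.supp i.2.1 i.2.2)

theorem Env.integral_eval (E : Env P) (i : ℕ × Fin P.U × Fin P.K) :
    ∫ r, r i ∂E.law = E.theta i.2.1 i.2.2 := by
  rw [Env.theta, ← (E.measurePreserving_eval i).map_eq,
    integral_map (f := fun x => x) (E.measurePreserving_eval i).measurable.aemeasurable
      aestronglyMeasurable_id]

/-- A measurable function with values in an interval is integrable. -/
theorem integrable_of_ae_mem_Icc {Ω : Type*} [MeasurableSpace Ω] {μ : Measure Ω}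
    [IsFiniteMeasure μ] {f : Ω → ℝ} (hf : Measurable f) {a b : ℝ}
    (h : ∀ᵐ ω ∂μ, f ω ∈ Set.Icc a b) : Integrable f μ :=
  memLp_one_iff_integrable.1 (memLp_of_bounded h hf.aestronglyMeasurable 1)

theorem Env.theta_mem_Icc (E : Env P) (u : Fin P.U) (k : Fin P.K) :
    E.theta u k ∈ Set.Icc (0 : ℝ) 1 := by
  have := E.prob u k
  refine ⟨integral_nonneg_of_ae ((E.supp u k).mono fun x hx => hx.1), ?_⟩
  have := integral_mono_of_nonneg ((E.supp u k).mono fun x hx => hx.1) (integrable_const (1 : ℝ))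
    ((E.supp u k).mono fun x hx => hx.2)
  simpa [Env.theta] using this

theorem Env.value_nonneg (E : Env P) (π : Matching P) : 0 ≤ E.value π :=
  Finset.sum_nonneg fun u _ => (E.theta_mem_Icc u (π u)).1

theorem Env.value_le (E : Env P) (π : Matching P) : E.value π ≤ P.U := by
  refine (Finset.sum_le_sum fun u _ => (E.theta_mem_Icc u (π u)).2).trans ?_
  simp

theorem Env.opt_le (E : Env P) : E.opt ≤ P.U := by
  obtain ⟨π, -, hπ⟩ := E.isGreatest_opt.1
  exact hπ ▸ E.value_le π

/-! ### The rewards of a learner -/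

variable (A : Learner P)

/-- The learner does not anticipate: what it has seen before round `t` depends only on the earlier
rows of the table. -/
theorem Learner.history_congr {r r' : Table P} {t : ℕ}
    (h : ∀ s < t, ∀ u k, r (s, u, k) = r' (s, u, k)) :
    A.history r t = A.history r' t := by
  induction t with
  | zero => rfl
  | succ t ih =>
    have ih := ih fun s hs => h s (hs.trans t.lt_succ_self)
    simp only [Learner.history, ih, h t t.lt_succ_self]

theorem Learner.length_history (r : Table P) (t : ℕ) : (A.history r t).length = t := by
  induction t with
  | zero => rfl
  | succ t ih => rw [Learner.history, List.length_cons, ih]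

variable {A}

/-- The matching of round `t` is a function of the finite block `S` of earlier entries, which is
independent of any entry of round `t`. -/
theorem Learner.indepFun_play (hA : ∀ t u, Measurable fun r => A.play r t u)
    (E : Env P) (t : ℕ) (u : Fin P.U) (k : Fin P.K) :
    IndepFun (fun r => A.play r t u) (fun r : Table P => r (t, u, k)) E.law := by
  classical
  let S : Finset (ℕ × Fin P.U × Fin P.K) := Finset.range t ×ˢ Finset.univ
  have hdisj : Disjoint S {(t, u, k)} := by simp [S]
  have hind := E.iIndepFun_eval.indepFun_finset S {(t, u, k)} hdisj fun i => measurable_pi_apply i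
  -- Padding the block by zeros gives a table against which the learner can be run; up to round `t`
  -- it behaves as on the original one.
  let ext : (S → ℝ) → Table P := fun v i => if h : i ∈ S then v ⟨i, h⟩ else 0
  have hext : Measurable ext := by
    refine measurable_pi_iff.2 fun i => ?_
    by_cases h : i ∈ S
    · simpa [ext, h] using measurable_pi_apply _
    · simp [ext, h]
  have heval : Measurable fun v : ({(t, u, k)} : Finset (ℕ × Fin P.U × Fin P.K)) → ℝ =>
      v ⟨(t, u, k), by simp⟩ := measurable_pi_apply _
  have := hind.comp ((hA t u).comp hext) heval
  convert this using 1
  · funext r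
    simp only [Function.comp, Learner.play]
    rw [A.history_congr (r' := ext fun i => r i)]
    intro s hs u' k'
    simp [ext, S, hs]
  · rfl

theorem Learner.measurable_reward_at (hA : ∀ t u, Measurable fun r => A.play r t u)
    (t : ℕ) (u : Fin P.U) :
    Measurable fun r : Table P => r (t, u, A.play r t u) :=
  RealRAM.measurable_apply_countable (f := fun k (r : Table P) => r (t, u, k))
    (fun _ => measurable_pi_apply _) (hA t u)

theorem Learner.integrable_reward_at (hA : ∀ t u, Measurable fun r => A.play r t u)
    (E : Env P) (t : ℕ) (u : Fin P.U) :
    Integrable (fun r : Table P => r (t, u, A.play r t u)) E.law :=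
  integrable_of_ae_mem_Icc (Learner.measurable_reward_at hA t u)
    (E.ae_mem_Icc.mono fun _ hr => hr _)

theorem Learner.measurable_theta_at (hA : ∀ t u, Measurable fun r => A.play r t u)
    (E : Env P) (t : ℕ) (u : Fin P.U) :
    Measurable fun r : Table P => E.theta u (A.play r t u) :=
  (measurable_from_top (f := E.theta u)).comp (hA t u)

/-- The expected reward of a round given by the expected rewards of the arms. -/
theorem Learner.integral_reward_at (hA : ∀ t u, Measurable fun r => A.play r t u)
    (E : Env P) (t : ℕ) (u : Fin P.U) :
    ∫ r, r (t, u, A.play r t u) ∂E.law = ∫ r, E.theta u (A.play r t u) ∂E.law := by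
  classical
  -- Decomposing along the arm played makes each summand a product of two independent variables.
  let I : Fin P.K → Table P → ℝ := fun k r => if A.play r t u = k then 1 else 0
  have hI : ∀ k, Measurable (I k) := fun k =>
    (measurable_from_top (f := fun l : Fin P.K => if l = k then (1 : ℝ) else 0)).comp (hA t u)
  have hI01 : ∀ k r, I k r ∈ Set.Icc (0 : ℝ) 1 := fun k r => by
    simp only [I]; split_ifs <;> simp
  have hIint : ∀ k, Integrable (I k) E.law := fun k =>
    integrable_of_ae_mem_Icc (hI k) (.of_forall (hI01 k))
  have h₁ : ∀ r : Table P, r (t, u, A.play r t u) = ∑ k, I k r * r (t, u, k) := fun r => by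
    simp [I]
  have h₂ : ∀ r : Table P, E.theta u (A.play r t u) = ∑ k, I k r * E.theta u k := fun r => by
    simp [I]
  simp_rw [h₁, h₂]
  rw [integral_finsetSum, integral_finsetSum]
  · refine Finset.sum_congr rfl fun k _ => ?_
    have hind : IndepFun (I k) (fun r : Table P => r (t, u, k)) E.law :=
      (Learner.indepFun_play hA E t u k).comp
        (φ := fun l : Fin P.K => if l = k then (1 : ℝ) else 0) (ψ := id)
        measurable_from_top measurable_id
    rw [hind.integral_fun_mul_eq_mul_integral (hI k).aestronglyMeasurable
      (measurable_pi_apply _).aestronglyMeasurable, E.integral_eval, integral_mul_const]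
  · exact fun k _ => (hIint k).mul_const _
  · intro k _
    refine integrable_of_ae_mem_Icc (a := 0) (b := 1) ((hI k).mul (measurable_pi_apply _)) ?_
    filter_upwards [E.ae_mem_Icc] with r hr
    exact ⟨mul_nonneg (hI01 k r).1 (hr _).1, mul_le_one₀ (hI01 k r).2 (hr _).1 (hr _).2⟩

theorem Learner.integrable_reward (hA : ∀ t u, Measurable fun r => A.play r t u)
    (E : Env P) : Integrable A.reward E.law :=
  integrable_finsetSum _ fun t _ => integrable_finsetSum _ fun u _ =>
    Learner.integrable_reward_at hA E t u

theorem Learner.integrable_value (hA : ∀ t u, Measurable fun r => A.play r t u)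
    (E : Env P) (t : ℕ) :
    Integrable (fun r => E.value (A.play r t)) E.law :=
  integrable_finsetSum _ fun u _ => integrable_of_ae_mem_Icc
    (Learner.measurable_theta_at hA E t u) (.of_forall fun _ => E.theta_mem_Icc _ _)

theorem Learner.integral_reward (hA : ∀ t u, Measurable fun r => A.play r t u)
    (E : Env P) :
    ∫ r, A.reward r ∂E.law = ∑ t ∈ Finset.range P.T, ∫ r, E.value (A.play r t) ∂E.law := by
  unfold Learner.reward Env.value
  rw [integral_finsetSum _ fun t _ => integrable_finsetSum _ fun u _ =>
    Learner.integrable_reward_at hA E t u]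
  refine Finset.sum_congr rfl fun t _ => ?_
  rw [integral_finsetSum _ fun u _ => Learner.integrable_reward_at hA E t u,
    integral_finsetSum _ fun u _ => integrable_of_ae_mem_Icc
      (Learner.measurable_theta_at hA E t u) (.of_forall fun _ => E.theta_mem_Icc _ _)]
  exact Finset.sum_congr rfl fun u _ => Learner.integral_reward_at hA E t u

/-! ### The estimation error -/

/-- The mean absolute deviation of a sum of `n` rewards of an arm is at most `√n`. -/
theorem Env.integral_abs_sum_sub_le (E : Env P) (u : Fin P.U) (k : Fin P.K) {I : Finset ℕ}
    (hI : 0 < I.card) :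
    Integrable (fun r : Table P => |∑ s ∈ I, max 0 (r (s, u, k)) - I.card * E.theta u k|) E.law ∧
    ∫ r : Table P, |∑ s ∈ I, max 0 (r (s, u, k)) - I.card * E.theta u k| ∂E.law ≤
      √I.card := by
  have hmeas : ∀ s, Measurable fun r : Table P => r (s, u, k) := fun s => measurable_pi_apply _
  have hmem : ∀ s, MemLp (fun r : Table P => r (s, u, k)) 2 E.law := fun s =>
    memLp_of_bounded (E.ae_mem_Icc.mono fun r hr => hr (s, u, k)) (hmeas s).aestronglyMeasurable 2
  set Y : Table P → ℝ := ∑ s ∈ I, fun r => r (s, u, k) with hY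
  have hYmem : MemLp Y 2 E.law := memLp_finsetSum' _ fun s _ => hmem s
  have hYint : ∫ r, Y r ∂E.law = I.card * E.theta u k := by
    simp only [hY, Finset.sum_apply]
    rw [integral_finsetSum _ fun s _ => (hmem s).integrable (by norm_num)]
    simp [E.integral_eval]
  have hvar : variance Y E.law ≤ I.card := by
    rw [hY, IndepFun.variance_sum fun s _ => hmem s]
    · calc ∑ s ∈ I, variance (fun r : Table P => r (s, u, k)) E.law ≤ ∑ s ∈ I, (1 : ℝ) := by
            refine Finset.sum_le_sum fun s _ => ?_
            -- A variable with values in `[0, 1]` has variance at most `1/4`; the bound `1` is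
            -- enough.
            refine (variance_le_sq_of_bounded (E.ae_mem_Icc.mono fun r hr => hr (s, u, k))
              (hmeas s).aemeasurable).trans (by norm_num)
        _ = I.card := by simp
    · intro s _ s' _ hss
      exact E.iIndepFun_eval.indepFun (by simpa using hss)
  have hsq : Integrable (fun r => (Y r - I.card * E.theta u k) ^ 2) E.law :=
    (hYmem.sub (memLp_const _)).integrable_sq
  have hvar' : ∫ r, (Y r - I.card * E.theta u k) ^ 2 ∂E.law ≤ I.card := by
    rw [variance_eq_integral hYmem.1.aemeasurable, hYint] at hvar
    exact hvar
  have hae : (fun r : Table P => |∑ s ∈ I, max 0 (r (s, u, k)) - I.card * E.theta u k|) =ᵐ[E.law]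
      fun r => |Y r - I.card * E.theta u k| := by
    filter_upwards [E.ae_mem_Icc] with r hr
    simp only [hY, Finset.sum_apply]
    congr 2
    exact Finset.sum_congr rfl fun s _ => max_eq_right (hr _).1
  have hint : Integrable (fun r => |Y r - I.card * E.theta u k|) E.law :=
    ((hYmem.integrable (by norm_num)).sub (integrable_const _)).abs
  refine ⟨hint.congr hae.symm, ?_⟩
  rw [integral_congr_ae hae]
  have hpos : 0 < √(I.card : ℝ) := Real.sqrt_pos.2 (by exact_mod_cast hI)
  have hss : √(I.card : ℝ) * √(I.card : ℝ) = I.card := Real.mul_self_sqrt (Nat.cast_nonneg _)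
  -- Instead of the Cauchy–Schwarz inequality, `|x| ≤ x ^ 2 / (2 * s) + s / 2` is integrated with `s
  -- = √n`, the choice that balances both terms.
  calc ∫ r, |Y r - I.card * E.theta u k| ∂E.law
      ≤ ∫ r, ((Y r - I.card * E.theta u k) ^ 2 * (1 / (2 * √I.card)) + √I.card / 2) ∂E.law := by
        refine integral_mono hint ((hsq.mul_const _).add (integrable_const _)) fun r => ?_
        have : |Y r - I.card * E.theta u k| * (2 * √I.card) ≤
            (Y r - I.card * E.theta u k) ^ 2 + √I.card * √I.card := by
          nlinarith [sq_nonneg (|Y r - I.card * E.theta u k| - √I.card),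
            sq_abs (Y r - I.card * E.theta u k)]
        rw [← le_div_iff₀ (by positivity)] at this
        refine this.trans (le_of_eq ?_)
        field_simp
    _ = (∫ r, (Y r - I.card * E.theta u k) ^ 2 ∂E.law) * (1 / (2 * √I.card)) + √I.card / 2 := by
        rw [integral_add (hsq.mul_const _) (integrable_const _), integral_mul_const]
        simp
    _ ≤ (√I.card * √I.card) * (1 / (2 * √I.card)) + √I.card / 2 := by
        rw [hss]
        gcongr
    _ = √I.card := by field_simp; ring

end CBR

namespace CBR

open RealRAM (exploreLen exploredSum)

variable {P : Params}

/-! ### The regret of exploring, then committing -/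

/-- Exploration follows a fixed schedule, so the recorded sums involve fixed entries of the table
and not the choices of the learner. Their independence is that of the table. -/
theorem exploredSum_history {A : Learner P}
    (hexp : ∀ h : List (Obs P), h.length < exploreLen P.T * P.K →
      ∀ u, (A h u : ℕ) = h.length % P.K) (r : Table P) (t : ℕ) (u : Fin P.U) (k : Fin P.K) :
    exploredSum (A.history r t) u k =
      ∑ s ∈ (Finset.range t).filter fun s => s < exploreLen P.T * P.K ∧ s % P.K = k,
        max 0 (r (s, u, k)) := by
  rw [Finset.sum_filter]
  induction t with
  | zero => rfl
  | succ t ih =>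
    rw [Learner.history, exploredSum, ih, Finset.sum_range_succ, A.length_history]
    congr 1
    split_ifs with h
    · have : A (A.history r t) u = k := by
        apply Fin.ext
        rw [hexp _ (by rw [A.length_history]; exact h.1), A.length_history, h.2]
      rw [this]
    · rfl

/-- The exploration rounds of an arm. -/
def exploreRounds (P : Params) (k : Fin P.K) : Finset ℕ :=
  (Finset.range (exploreLen P.T * P.K)).filter fun s => s % P.K = k

theorem card_exploreRounds (k : Fin P.K) : (exploreRounds P k).card = exploreLen P.T := by
  have h := Nat.count_modEq_card (exploreLen P.T * P.K) P.K_pos k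
  rw [Nat.count_eq_card_filter_range, Nat.mul_mod_left, Nat.mul_div_cancel _ P.K_pos,
    if_neg (Nat.not_lt_zero _), add_zero] at h
  rw [← h, exploreRounds]
  simp only [Nat.ModEq, Nat.mod_eq_of_lt k.2]

theorem exploredSum_history_of_le {A : Learner P}
    (hexp : ∀ h : List (Obs P), h.length < exploreLen P.T * P.K →
      ∀ u, (A h u : ℕ) = h.length % P.K) (r : Table P) {t : ℕ} (ht : exploreLen P.T * P.K ≤ t)
    (u : Fin P.U) (k : Fin P.K) :
    exploredSum (A.history r t) u k = ∑ s ∈ exploreRounds P k, max 0 (r (s, u, k)) := by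
  rw [exploredSum_history hexp]
  congr 1
  ext s
  simp only [exploreRounds, Finset.mem_filter, Finset.mem_range]
  omega

/-- The total error of the estimates. -/
noncomputable def Env.estimationError (E : Env P) (r : Table P) : ℝ :=
  ∑ u, ∑ k, |∑ s ∈ exploreRounds P k, max 0 (r (s, u, k)) - exploreLen P.T * E.theta u k|

theorem Env.estimationError_bound (E : Env P) (hN : 0 < exploreLen P.T) :
    Integrable E.estimationError E.law ∧
      ∫ r, E.estimationError r ∂E.law ≤ P.U * P.K * √(exploreLen P.T) := by
  have h := fun u k => E.integral_abs_sum_sub_le u k (I := exploreRounds P k)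
    (by rwa [card_exploreRounds])
  simp only [card_exploreRounds] at h
  refine ⟨integrable_finsetSum _ fun u _ => integrable_finsetSum _ fun k _ => (h u k).1, ?_⟩
  unfold Env.estimationError
  rw [integral_finsetSum _ fun u _ => integrable_finsetSum _ fun k _ => (h u k).1]
  calc ∑ u, ∫ r, ∑ k, |∑ s ∈ exploreRounds P k, max 0 (r (s, u, k)) -
        exploreLen P.T * E.theta u k| ∂E.law
      ≤ ∑ u : Fin P.U, ∑ k : Fin P.K, √(exploreLen P.T : ℝ) := by
        refine Finset.sum_le_sum fun u _ => ?_
        rw [integral_finsetSum _ fun k _ => (h u k).1]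
        exact Finset.sum_le_sum fun k _ => (h u k).2
    _ = P.U * P.K * √(exploreLen P.T) := by simp; ring

/-- A matching uses one arm for each user, so its error is part of the total error. The bound is
uniform in `π`, as needed for the committed matching, which depends on the estimates. -/
theorem Env.abs_sum_sub_value_le (E : Env P) (r : Table P) (π : Matching P) :
    |∑ u, ∑ s ∈ exploreRounds P (π u), max 0 (r (s, u, π u)) - exploreLen P.T * E.value π| ≤
      E.estimationError r := by
  rw [Env.value, Finset.mul_sum, ← Finset.sum_sub_distrib]
  refine (Finset.abs_sum_le_sum_abs _ _).trans (Finset.sum_le_sum fun u _ => ?_)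
  exact Finset.single_le_sum (f := fun k =>
    |∑ s ∈ exploreRounds P k, max 0 (r (s, u, k)) - exploreLen P.T * E.theta u k|)
    (fun _ _ => abs_nonneg _) (Finset.mem_univ (π u))

/-- The regret of a learner that explores each arm in turn and then plays matchings that have at
least half of the best empirical value. -/
theorem alphaRegret_le_of_explore {A : Learner P} (hA : ∀ t u, Measurable fun r => A.play r t u)
    (hexp : ∀ h : List (Obs P), h.length < exploreLen P.T * P.K →
      ∀ u, (A h u : ℕ) = h.length % P.K)
    (hhalf : ∀ h : List (Obs P), exploreLen P.T * P.K ≤ h.length → ∀ π, Feasible P π →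
      ∑ u, exploredSum h u (π u) ≤ 2 * ∑ u, exploredSum h u (A h u))
    (hN : 0 < exploreLen P.T) (E : Env P) :
    alphaRegret (1 / 2) E A ≤ P.U * P.K * exploreLen P.T / 2 +
      P.T * (3 / 2 * (P.U * P.K / √(exploreLen P.T))) := by
  have hNr : (0 : ℝ) < exploreLen P.T := by exact_mod_cast hN
  obtain ⟨herr, herr'⟩ := E.estimationError_bound hN
  have hround : ∀ t, 1 / 2 * E.opt - ∫ r, E.value (A.play r t) ∂E.law ≤
      (if t < exploreLen P.T * P.K then (P.U / 2 : ℝ) else 0) +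
        3 / 2 * (P.U * P.K / √(exploreLen P.T)) := by
    intro t
    split_ifs with ht
    · have h₁ : 0 ≤ ∫ r, E.value (A.play r t) ∂E.law :=
        integral_nonneg fun r => E.value_nonneg _
      have h₂ : 0 ≤ 3 / 2 * (P.U * P.K / √(exploreLen P.T : ℝ)) := by positivity
      linarith [E.opt_le]
    · obtain ⟨π, hπ, hopt⟩ := E.isGreatest_opt.1
      have hpt : ∀ r, 1 / 2 * E.opt - 3 / 2 / exploreLen P.T * E.estimationError r ≤
          E.value (A.play r t) := by
        intro r
        have h₁ := abs_le.1 (E.abs_sum_sub_value_le r π)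
        have h₂ := abs_le.1 (E.abs_sum_sub_value_le r (A.play r t))
        have h₃ := hhalf (A.history r t) (by rw [A.length_history]; omega) π hπ
        simp only [exploredSum_history_of_le hexp r (not_lt.1 ht)] at h₃
        rw [hopt] at h₁
        -- The optimal matching enters with factor `1/2` and the played one with factor `1`, each
        -- costing one total error: together `3/2`.
        have h₄ : exploreLen P.T * (1 / 2 * E.opt - E.value (A.play r t)) ≤
            3 / 2 * E.estimationError r := by
          simp only [Learner.play] at *
          linarith [h₁.1, h₂.2]
        have h₅ : 1 / 2 * E.opt - E.value (A.play r t) ≤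
            3 / 2 * E.estimationError r / exploreLen P.T := by
          rw [le_div_iff₀ hNr]
          linarith
        rw [div_mul_eq_mul_div (3 / 2)]
        linarith
      have hint := integral_mono ((integrable_const _).sub (herr.const_mul _))
        (Learner.integrable_value hA E t) hpt
      simp only [Pi.sub_apply] at hint
      rw [integral_sub (integrable_const _) (herr.const_mul _),
        integral_const_mul (3 / 2 / (exploreLen P.T : ℝ))] at hint
      simp only [integral_const, probReal_univ, smul_eq_mul, one_mul] at hint
      have hle : 3 / 2 / exploreLen P.T * ∫ r, E.estimationError r ∂E.law ≤
          3 / 2 * (P.U * P.K / √(exploreLen P.T)) := by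
        calc 3 / 2 / exploreLen P.T * ∫ r, E.estimationError r ∂E.law
            ≤ 3 / 2 / exploreLen P.T * (P.U * P.K * √(exploreLen P.T)) := by gcongr
          _ = 3 / 2 * (P.U * P.K * (√(exploreLen P.T) / exploreLen P.T)) := by ring
          _ = 3 / 2 * (P.U * P.K / √(exploreLen P.T)) := by
            rw [Real.sqrt_div_self, div_eq_mul_inv _ √(exploreLen P.T : ℝ)]
      linarith
  have hsum := Finset.sum_le_sum fun t (_ : t ∈ Finset.range P.T) => hround t
  rw [Finset.sum_sub_distrib, Finset.sum_add_distrib, ← Learner.integral_reward hA E] at hsum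
  simp only [Finset.sum_const, Finset.card_range, nsmul_eq_mul] at hsum
  -- The horizon may end before the exploration does; an upper bound on the number of exploration
  -- rounds suffices.
  have hexpl : ∑ t ∈ Finset.range P.T, (if t < exploreLen P.T * P.K then (P.U / 2 : ℝ) else 0) ≤
      P.U * P.K * exploreLen P.T / 2 := by
    rw [← Finset.sum_filter, Finset.sum_const, nsmul_eq_mul]
    have hcard : ((Finset.range P.T).filter fun t => t < exploreLen P.T * P.K).card ≤
        exploreLen P.T * P.K := by
      refine (Finset.card_le_card fun t ht => ?_).trans (Finset.card_range _).le
      exact Finset.mem_range.2 (Finset.mem_filter.1 ht).2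
    have hcard' : (((Finset.range P.T).filter fun t => t < exploreLen P.T * P.K).card : ℝ) ≤
        exploreLen P.T * P.K := by exact_mod_cast hcard
    have := mul_le_mul_of_nonneg_right hcard' (by positivity : (0 : ℝ) ≤ P.U / 2)
    linarith
  rw [alphaRegret]
  linarith

theorem beta_nonneg (P : Params) : 0 ≤ beta P :=
  div_nonneg (Nat.cast_nonneg _) (Real.iInf_nonneg fun k => (P.cost_pos k).le)

/-- With `x = T^(2/3)`, so `x ^ 3 = T ^ 2`, minimality gives `x ≤ N ≤ x + 1 ≤ 2 * x`, and `T ^ 2 = x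
^ 3 ≤ x ^ 2 * N` gives the last bound. -/
theorem exploreLen_bounds {T : ℕ} (hT : 0 < T) :
    0 < exploreLen T ∧ (exploreLen T : ℝ) ≤ 2 * (T : ℝ) ^ (2 / 3 : ℝ) ∧
      T / √(exploreLen T) ≤ (T : ℝ) ^ (2 / 3 : ℝ) := by
  have hTr : (1 : ℝ) ≤ T := by exact_mod_cast hT
  set x : ℝ := (T : ℝ) ^ (2 / 3 : ℝ) with hx
  have hx1 : 1 ≤ x := Real.one_le_rpow hTr (by norm_num)
  have hx3 : x ^ 3 = (T : ℝ) ^ 2 := by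
    rw [hx, ← Real.rpow_natCast, ← Real.rpow_mul (by positivity), ← Real.rpow_natCast]
    norm_num
  have hpos : 0 < exploreLen T := RealRAM.lt_exploreLen_iff.2 (by positivity)
  have hge : x ≤ exploreLen T := by
    have : T ^ 2 ≤ exploreLen T ^ 3 :=
      not_lt.1 fun h => lt_irrefl _ (RealRAM.lt_exploreLen_iff.2 h)
    rw [← pow_le_pow_iff_left₀ (by positivity) (by positivity) (n := 3) (by norm_num), hx3]
    exact_mod_cast this
  refine ⟨hpos, ?_, ?_⟩
  · have : (exploreLen T - 1) ^ 3 < T ^ 2 := RealRAM.lt_exploreLen_iff.1 (by omega)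
    have hlt : ((exploreLen T - 1 : ℕ) : ℝ) ≤ x := by
      rw [← pow_le_pow_iff_left₀ (by positivity) (by positivity) (n := 3) (by norm_num), hx3]
      exact_mod_cast this.le
    rw [Nat.cast_sub hpos] at hlt
    push_cast at hlt
    linarith
  · have hNr : (0 : ℝ) < exploreLen T := by exact_mod_cast hpos
    rw [div_le_iff₀ (Real.sqrt_pos.2 hNr),
      ← pow_le_pow_iff_left₀ (by positivity) (by positivity) (n := 2) (by norm_num), mul_pow,
      Real.sq_sqrt hNr.le, ← hx3, pow_succ]
    gcongr

/-- The regret bound in terms of the parameters. -/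
theorem alphaRegret_le_of_half {A : Learner P} (hA : ∀ t u, Measurable fun r => A.play r t u)
    (hexp : ∀ h : List (Obs P), h.length < exploreLen P.T * P.K →
      ∀ u, (A h u : ℕ) = h.length % P.K)
    (hhalf : ∀ h : List (Obs P), exploreLen P.T * P.K ≤ h.length → ∀ π, Feasible P π →
      ∑ u, exploredSum h u (π u) ≤ 2 * ∑ u, exploredSum h u (A h u)) (E : Env P) :
    alphaRegret (1 / 2) E A ≤
      5 * (P.U * ((P.K : ℝ) + beta P) ^ (4 / 3 : ℝ) * (P.T : ℝ) ^ (2 / 3 : ℝ) *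
        Real.log P.T ^ (1 / 3 : ℝ)) := by
  have hT0 : 0 < P.T := P.U_pos.trans_le P.U_le_T
  rcases Nat.lt_or_ge P.T 2 with hT | hT
  -- Here `log T = 0` and the bound is `0`. But `K ≤ T` leaves a single arm, hence a single
  -- matching, and the regret is `opt / 2 - opt ≤ 0`.
  · have hT1 : P.T = 1 := by omega
    have hK1 : P.K = 1 := by have := P.K_pos; have := P.K_le_T; omega
    have : Subsingleton (Fin P.K) := hK1 ▸ inferInstanceAs (Subsingleton (Fin 1))
    obtain ⟨π, -, hπ⟩ := E.isGreatest_opt.1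
    have hval : ∀ r t, E.value (A.play r t) = E.opt := fun r t => by
      rw [← hπ, Subsingleton.elim π (A.play r t)]
    have hopt : 0 ≤ E.opt := hπ ▸ E.value_nonneg π
    rw [alphaRegret, Learner.integral_reward hA E, hT1]
    simp only [hval, integral_const, probReal_univ, Finset.range_one, Finset.sum_singleton,
      Nat.cast_one, Real.log_one, smul_eq_mul]
    rw [Real.zero_rpow (by norm_num)]
    linarith
  · obtain ⟨hN, hN₁, hN₂⟩ := exploreLen_bounds hT0
    have hreg := alphaRegret_le_of_explore hA hexp hhalf hN E
    set x : ℝ := (P.T : ℝ) ^ (2 / 3 : ℝ)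
    -- For `T ≥ 2`, `log T ≥ log 2 > 1/8`.
    have hlog : 1 / 2 ≤ Real.log P.T ^ (1 / 3 : ℝ) := by
      have h₁ : (1 / 2 : ℝ) ^ 3 ≤ Real.log P.T := by
        have h₂ : Real.log 2 ≤ Real.log P.T :=
          Real.log_le_log (by norm_num) (by exact_mod_cast hT)
        linarith [Real.log_two_gt_d9]
      calc (1 / 2 : ℝ) = ((1 / 2 : ℝ) ^ 3) ^ (1 / 3 : ℝ) := by
            rw [← Real.rpow_natCast, ← Real.rpow_mul (by norm_num)]
            norm_num
        _ ≤ _ := Real.rpow_le_rpow (by positivity) h₁ (by norm_num)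
    have hK : (P.K : ℝ) ≤ ((P.K : ℝ) + beta P) ^ (4 / 3 : ℝ) := by
      have hK1 : (1 : ℝ) ≤ P.K := by exact_mod_cast P.K_pos
      have hb := beta_nonneg P
      calc (P.K : ℝ) ≤ P.K + beta P := by linarith
        _ ≤ _ := Real.self_le_rpow_of_one_le (by linarith) (by norm_num)
    set y : ℝ := ((P.K : ℝ) + beta P) ^ (4 / 3 : ℝ)
    have hy : 0 ≤ y := (Nat.cast_nonneg _).trans hK
    have hx : 0 ≤ x := by positivity
    calc alphaRegret (1 / 2) E A
        ≤ P.U * P.K * exploreLen P.T / 2 +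
          P.T * (3 / 2 * (P.U * P.K / √(exploreLen P.T))) := hreg
      _ = P.U * P.K * exploreLen P.T / 2 +
          3 / 2 * (P.U * P.K * (P.T / √(exploreLen P.T))) := by ring
      _ ≤ P.U * P.K * (2 * x) / 2 + 3 / 2 * (P.U * P.K * x) := by gcongr
      -- The constants add up to `1 + 3/2 = 5/2`; the factor `1/2` is set aside to be absorbed by
      -- the logarithm.
      _ = 5 * (P.U * P.K * x * (1 / 2)) := by ring
      _ ≤ 5 * (P.U * y * x * Real.log P.T ^ (1 / 3 : ℝ)) := by gcongr

/-! ### The learner of the program -/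

theorem feas_iff_feasible {out : ℕ → ℕ} {π : Matching P} (h : ∀ u : Fin P.U, out u = π u) :
    GreedyMax.Feas P.U P.K ((RealRAM.initMem P).real 0) P.B out ↔ Feasible P π := by
  have himg : (Finset.range P.U).image out = (Finset.univ.image π).map Fin.valEmbedding := by
    ext k
    simp only [Finset.mem_image, Finset.mem_range, Finset.mem_map, Finset.mem_univ, true_and,
      Fin.valEmbedding_apply, exists_exists_eq_and]
    exact ⟨fun ⟨u, hu, hk⟩ => ⟨⟨u, hu⟩, by rw [← h, hk]⟩, fun ⟨u, hk⟩ => ⟨u, u.2, by rw [h, hk]⟩⟩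
  have hsum : ∑ k ∈ (Finset.range P.U).image out, (RealRAM.initMem P).real 0 k =
      ∑ k ∈ Finset.univ.image π, P.cost k := by
    rw [himg, Finset.sum_map]
    exact Finset.sum_congr rfl fun k _ => by simp [RealRAM.initMem]
  rw [Feasible, ← hsum]
  exact ⟨fun hf => hf.cost, fun hc => ⟨fun u hu => h ⟨u, hu⟩ ▸ (π ⟨u, hu⟩).2, hc⟩⟩

theorem feasible_const (k : Fin P.K) : Feasible P fun _ => k := by
  have : Nonempty (Fin P.U) := ⟨⟨0, P.U_pos⟩⟩
  rw [Feasible, Finset.image_const Finset.univ_nonempty, Finset.sum_singleton]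
  exact P.cost_le k

end CBR

/-! ### The main theorem -/

theorem mainTheorem12 :
    ∃ (c : RealRAM.Prog) (C₁ : ℕ) (C₂ : ℝ), ∀ P : CBR.Params, ∃ A : CBR.Learner P,
      RealRAM.Implements c A (C₁ * P.K ^ 3 * P.U) ∧
      (∀ h : List (CBR.Obs P), h.length < P.T → CBR.Feasible P (A h)) ∧
      ∀ E : CBR.Env P,
        Integrable (CBR.Learner.reward A) E.law ∧
        CBR.alphaRegret (1 / 2) E A ≤
          C₂ * (P.U * ((P.K : ℝ) + CBR.beta P) ^ (4 / 3 : ℝ) * (P.T : ℝ) ^ (2 / 3 : ℝ) *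
            Real.log P.T ^ (1 / 3 : ℝ)) := by
  refine ⟨RealRAM.banditP, 1000, 5, fun P => ?_⟩
  obtain ⟨himp, hout⟩ := RealRAM.implements_progLearner (f := RealRAM.stepBound P)
    (c := RealRAM.banditP) (P := P) fun h m hm => by
      obtain ⟨n, m', he, hn, -, hg⟩ := RealRAM.banditP_spec hm
      exact ⟨n, m', he, hn, hg.lt⟩
  set A := RealRAM.progLearner (RealRAM.stepBound P) RealRAM.banditP P
  -- Since the program halts whatever is observed, every list of observations is reached by some
  -- memory, and the guarantees hold for all of them.
  have hgood : ∀ h : List (CBR.Obs P), ∃ out : ℕ → ℕ, RealRAM.GoodOutput P h out ∧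
      ∀ u : Fin P.U, out u = A h u := by
    intro h
    have hround : ∃ m, RealRAM.AtRound RealRAM.banditP P h m := by
      induction h with
      | nil => exact ⟨_, .start⟩
      | cons x h ih =>
        obtain ⟨m, hm⟩ := ih
        obtain ⟨n, m', he, -⟩ := RealRAM.banditP_spec hm
        exact ⟨_, .next x hm he⟩
    obtain ⟨m, hm⟩ := hround
    obtain ⟨n, m', he, -, -, hg⟩ := RealRAM.banditP_spec hm
    exact ⟨_, hg, fun u => (hout h m n m' hm he u).symm⟩
  have hmeas : ∀ t u, Measurable fun r => A.play r t u := fun t u =>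
    RealRAM.measurable_progLearner _ _ _ t u
  refine ⟨A, himp, fun h _ => ?_, fun E => ⟨CBR.Learner.integrable_reward hmeas E,
    CBR.alphaRegret_le_of_half hmeas ?_ ?_ E⟩⟩
  · obtain ⟨out, hg, hu⟩ := hgood h
    rcases Nat.lt_or_ge h.length (RealRAM.exploreLen P.T * P.K) with hlt | hle
    · have : A h = fun _ => ⟨h.length % P.K, Nat.mod_lt _ P.K_pos⟩ := by
        funext u
        exact Fin.ext ((hu u).symm.trans (hg.explore hlt u u.2))
      rw [this]
      exact CBR.feasible_const _
    · exact (CBR.feas_iff_feasible hu).1 (hg.feas hle)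
  · intro h hlt u
    obtain ⟨out, hg, hu⟩ := hgood h
    rw [← hu, hg.explore hlt u u.2]
  · intro h hle π hπ
    obtain ⟨out, hg, hu⟩ := hgood h
    -- The greedy analysis uses maps on `ℕ`; the value outside the users is irrelevant.
    let σ : ℕ → ℕ := fun u => if hu : u < P.U then π ⟨u, hu⟩ else 0
    have hσ : ∀ u : Fin P.U, σ u = π u := fun u => by simp [σ]
    have := hg.half hle σ ((CBR.feas_iff_feasible hσ).2 hπ)
    simpa only [hσ, hu] using this
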